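/- Let $0<\alpha,\beta<1$ and $n\ge 1$. Let $\mathcal H=L^2\big[(-1,1),(1-x)^\alpha(1+x)^\beta\,dx\big]$ with inner product $\langle\cdot,\cdot\rangle$, let $$\ell[f](x)=-\frac{1}{(1-x)^{\alpha}(1+x)^{\beta}}\Big((1-x)^{\alpha+1}(1+x)^{\beta+1}f'(x)\Big)'$$ be the Jacobi differential expression, and let $\ell^n$ be its $n$-fold composition. The maximal domain $\mathcal D^n_{\max}$ is the set of $f\in\mathcal H$ with $f,f',\dots,f^{(2n-1)}$ locally absolutely continuous on $(-1,1)$ and $\ell^n[f]\in\mathcal H$; the minimal domain is $$\mathcal D^n_{\min}=\{f\in\mathcal D^n_{\max}:\ \langle \ell^n[f],g\rangle-\langle f,\ell^n[g]\rangle=0\ \text{ for all } g\in\mathcal D^n_{\max}\},$$ and $\mathbf L^n_{\min}$ is the operator acting by $\ell^n$ on $\mathcal D^n_{\min}$. Its defect spaces are $\mathcal D^n_{\pm}=\{f\in\mathcal D((\mathbf L^n_{\min})^*):(\mathbf L^n_{\min})^*f=\pm i f\}$. For $0\le j<n$ let $\varphi_j^{\pm},\psi_j^{\pm}$ be any (complex-valued)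 $C^\infty$ functions on $(-1,1)$ such that $\varphi_j^+(x)=(1-x)^j$ and $\psi_j^+(x)=(1-x)^{-\alpha+j}$ for $x$ near $1$ and both vanish near $-1$, while $\varphi_j^-(x)=(1+x)^j$ and $\psi_j^-(x)=(1+x)^{-\beta+j}$ for $x$ near $-1$ and both vanish near $1$. Put $\mathbf D^n_\pm=\operatorname{span}\{\varphi_j^\pm,\psi_j^\pm: 0\le j<n\}$. Then the sums $\mathcal D^n_+\dotplus\mathcal D^n_-$ and $\mathbf D^n_-\dotplus\mathbf D^n_+$ are direct, both are $4n$-dimensional subspaces of $\mathcal D^n_{\max}$ that meet $\mathcal D^n_{\min}$ only in $0$, and they are equal modulo the minimal domain: they have the same image in $\mathcal D^n_{\max}/\mathcal D^n_{\min}$, that is, $$\mathcal D^n_{\min}\dotplus\mathcal D^n_+\dotplus\mathcal D^n_-=\mathcal D^n_{\min}\dotplus\mathbf D^n_-\dotplus\mathbf D^n_+ .$$ -/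

import Mathlib

open MeasureTheory Set Filter Topology
open scoped ContDiff InnerProductSpace

namespace JacobiPowers

/-! ### The weighted Hilbert space and the Jacobi expression -/

/-- The measure `(1 - x) ^ α (1 + x) ^ β dx` on the interval `(-1, 1)`. -/
noncomputable def weightMeasure (α β : ℝ) : Measure ℝ :=
  (volume.restrict (Ioo (-1 : ℝ) 1)).withDensity
    fun x => ENNReal.ofReal ((1 - x) ^ α * (1 + x) ^ β)

/-- The complex Hilbert space `L² [(-1, 1), (1 - x) ^ α (1 + x) ^ β]`. -/
abbrev L2 (α β : ℝ) : Type := Lp ℂ 2 (weightMeasure α β)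

/-- The classical Jacobi differential expression
`ℓ[f](x) = - (1 - x) ^ (-α) (1 + x) ^ (-β) ((1 - x) ^ (α + 1) (1 + x) ^ (β + 1) f' (x))'`.
Only its values at points of `(-1, 1)` are ever used. -/
noncomputable def jacobi (α β : ℝ) (f : ℝ → ℂ) (x : ℝ) : ℂ :=
  -((((1 - x) ^ α * (1 + x) ^ β : ℝ) : ℂ)⁻¹ *
    deriv (fun y => (((1 - y) ^ (α + 1) * (1 + y) ^ (β + 1) : ℝ) : ℂ) * deriv f y) x)

/-- The `n`-th composition `ℓⁿ` of the Jacobi expression with itself. -/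
noncomputable def jacobiPow (α β : ℝ) (n : ℕ) : (ℝ → ℂ) → ℝ → ℂ :=
  (jacobi α β)^[n]

/-- `f` is locally absolutely continuous on `(-1, 1)`: absolutely continuous on every compact
subinterval. -/
def LocallyAC (f : ℝ → ℂ) : Prop :=
  ∀ a b : ℝ, -1 < a → a ≤ b → b < 1 → AbsolutelyContinuousOnInterval f a b

/-- `f` has derivatives up to order `2 n - 1` on `(-1, 1)` and `f, f', …, f ^ (2 n - 1)` are locally
absolutely continuous there. (Used for `n ≥ 1`.) -/
def IsRegular (n : ℕ) (f : ℝ → ℂ) : Prop :=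
  ContDiffOn ℝ (2 * n - 1 : ℕ) f (Ioo (-1 : ℝ) 1) ∧
    ∀ k < 2 * n, LocallyAC (iteratedDeriv k f)

/-! ### Additivity of `ℓⁿ` on regular functions -/

/-- `f` is `m` times differentiable at the point `x`. -/
def TimesDiffAt : ℕ → (ℝ → ℂ) → ℝ → Prop
  | 0, _, _ => True
  | 1, f, x => DifferentiableAt ℝ f x
  | m + 2, f, x => (∀ᶠ y in 𝓝 x, DifferentiableAt ℝ f y) ∧ TimesDiffAt (m + 1) (deriv f) x

theorem TimesDiffAt.congr : ∀ {m : ℕ} {f g : ℝ → ℂ} {x : ℝ}, f =ᶠ[𝓝 x] g →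
    TimesDiffAt m f x → TimesDiffAt m g x
  | 0, _, _, _, _, _ => trivial
  | 1, _, _, _, h, hf => h.differentiableAt_iff.1 hf
  | m + 2, _, _, _, h, hf =>
    ⟨(h.eventuallyEq_nhds.and hf.1).mono fun _ hy => hy.1.differentiableAt_iff.1 hy.2,
      TimesDiffAt.congr (m := m + 1) h.deriv hf.2⟩

theorem TimesDiffAt.differentiableAt : ∀ {m : ℕ} {f : ℝ → ℂ} {x : ℝ},
    TimesDiffAt (m + 1) f x → DifferentiableAt ℝ f x
  | 0, _, _, h => h
  | _ + 1, _, _, h => h.1.self_of_nhds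

theorem TimesDiffAt.of_succ : ∀ {m : ℕ} {f : ℝ → ℂ} {x : ℝ},
    TimesDiffAt (m + 1) f x → TimesDiffAt m f x
  | 0, _, _, _ => trivial
  | 1, _, _, h => h.1.self_of_nhds
  | m + 2, _, _, h => ⟨h.1, TimesDiffAt.of_succ (m := m + 1) h.2⟩

theorem TimesDiffAt.add : ∀ {m : ℕ} {f g : ℝ → ℂ} {x : ℝ},
    TimesDiffAt m f x → TimesDiffAt m g x → TimesDiffAt m (f + g) x
  | 0, _, _, _, _, _ => trivial
  | 1, _, _, _, hf, hg => DifferentiableAt.add hf hg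
  | m + 2, f, g, x, hf, hg => by
    refine ⟨(hf.1.and hg.1).mono fun y hy => hy.1.add hy.2, ?_⟩
    refine TimesDiffAt.congr (m := m + 1) ?_ (TimesDiffAt.add hf.2 hg.2)
    filter_upwards [hf.1, hg.1] with y h1 h2
    exact (deriv_add h1 h2).symm

theorem TimesDiffAt.mul : ∀ {m : ℕ} {c f : ℝ → ℂ} {x : ℝ},
    ContDiffAt ℝ ∞ c x → TimesDiffAt m f x → TimesDiffAt m (fun y => c y * f y) x
  | 0, _, _, _, _, _ => trivial
  | 1, _, _, _, hc, hf => DifferentiableAt.mul (hc.differentiableAt (by simp)) hf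
  | m + 2, c, f, x, hc, hf => by
    have hc1 : ∀ᶠ y in 𝓝 x, DifferentiableAt ℝ c y := by
      have h1 : ContDiffAt ℝ 1 c x := hc.of_le (by exact_mod_cast le_top)
      exact (h1.eventually (by simp)).mono fun y hy => hy.differentiableAt (by simp)
    have hc' : ContDiffAt ℝ ∞ (deriv c) x := by
      have h1 : ContDiffAt ℝ ∞ (fderiv ℝ c) x := hc.fderiv_right (by simp)
      exact h1.clm_apply contDiffAt_const
    refine ⟨(hc1.and hf.1).mono fun y hy => hy.1.mul hy.2, ?_⟩
    refine TimesDiffAt.congr (m := m + 1) ?_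
      (TimesDiffAt.add (TimesDiffAt.mul hc' hf.of_succ) (TimesDiffAt.mul hc hf.2))
    filter_upwards [hc1, hf.1] with y h1 h2
    exact (deriv_mul h1 h2).symm

theorem TimesDiffAt.of_contDiffOn : ∀ {m : ℕ} {f : ℝ → ℂ} {x : ℝ}, x ∈ Ioo (-1 : ℝ) 1 →
    ContDiffOn ℝ m f (Ioo (-1 : ℝ) 1) → DifferentiableAt ℝ (iteratedDeriv m f) x →
    TimesDiffAt (m + 1) f x
  | 0, f, x, _, _, h => by simpa [TimesDiffAt] using h
  | m + 1, f, x, hx, hf, h => by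
    have hf1 : ContDiffOn ℝ ((m : WithTop ℕ∞) + 1) f (Ioo (-1 : ℝ) 1) := hf.of_le (by simp)
    have hf' := (contDiffOn_succ_iff_deriv_of_isOpen isOpen_Ioo).1 hf1
    refine ⟨?_, TimesDiffAt.of_contDiffOn (m := m) hx hf'.2.2 ?_⟩
    · filter_upwards [isOpen_Ioo.mem_nhds hx] with y hy
      exact hf'.1.differentiableAt (isOpen_Ioo.mem_nhds hy)
    · rwa [← iteratedDeriv_succ']

theorem LocallyAC.ae_differentiableAt {f : ℝ → ℂ} (hf : LocallyAC f) :
    ∀ᵐ x ∂(volume.restrict (Ioo (-1 : ℝ) 1)), DifferentiableAt ℝ f x := by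
  rw [ae_restrict_iff' measurableSet_Ioo]
  have h : ∀ k : ℕ, ∀ᵐ x : ℝ,
      x ∈ uIcc (-1 + 1 / ((k : ℝ) + 2)) (1 - 1 / ((k : ℝ) + 2)) → DifferentiableAt ℝ f x := by
    intro k
    have h2 : (1 : ℝ) / ((k : ℝ) + 2) ≤ 1 / 2 :=
      one_div_le_one_div_of_le (by norm_num) (by linarith [(Nat.cast_nonneg k : (0 : ℝ) ≤ k)])
    have h3 : (0 : ℝ) < 1 / ((k : ℝ) + 2) := by positivity
    exact (hf _ _ (by linarith) (by linarith)
      (by linarith)).boundedVariationOn.ae_differentiableAt_of_mem_uIcc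
  filter_upwards [ae_all_iff.2 h] with x hx hmem
  obtain ⟨k, hk⟩ := exists_nat_gt (1 / min (x + 1) (1 - x))
  have hpos : 0 < min (x + 1) (1 - x) := lt_min (by linarith [hmem.1]) (by linarith [hmem.2])
  have hk' : 1 / ((k : ℝ) + 2) < min (x + 1) (1 - x) := by
    rw [div_lt_iff₀ (by positivity)]
    rw [div_lt_iff₀ hpos] at hk
    nlinarith
  have h1 := lt_of_lt_of_le hk' (min_le_left _ _)
  have h2 := lt_of_lt_of_le hk' (min_le_right _ _)
  refine hx k ?_
  rw [uIcc_of_le (by linarith)]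
  exact ⟨by linarith, by linarith⟩

theorem IsRegular.ae_timesDiffAt {n : ℕ} {f : ℝ → ℂ} (hf : IsRegular n f) :
    ∀ᵐ x ∂(volume.restrict (Ioo (-1 : ℝ) 1)), TimesDiffAt (2 * n) f x := by
  rcases Nat.eq_zero_or_pos n with rfl | hn
  · exact Eventually.of_forall fun x => trivial
  obtain ⟨m, hm⟩ : ∃ m, 2 * n = m + 1 := ⟨2 * n - 1, by omega⟩
  have hm' : 2 * n - 1 = m := by omega
  have h1 := hf.1
  rw [hm'] at h1
  filter_upwards [(hf.2 m (by omega)).ae_differentiableAt, ae_restrict_mem measurableSet_Ioo]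
    with x hx hmem
  rw [hm]
  exact TimesDiffAt.of_contDiffOn hmem h1 hx

theorem contDiffAt_weight (a b : ℝ) {x : ℝ} (hx : x ∈ Ioo (-1 : ℝ) 1) :
    ContDiffAt ℝ ∞ (fun y : ℝ => (((1 - y) ^ a * (1 + y) ^ b : ℝ) : ℂ)) x := by
  have h1 : ContDiffAt ℝ ∞ (fun y : ℝ => (1 - y) ^ a * (1 + y) ^ b) x := by
    refine ContDiffAt.mul ?_ ?_
    · exact (contDiffAt_const.sub contDiffAt_id).rpow_const_of_ne (by simp; linarith [hx.2])
    · exact (contDiffAt_const.add contDiffAt_id).rpow_const_of_ne (by simp; linarith [hx.1])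
  exact Complex.ofRealCLM.contDiff.contDiffAt.comp x h1

theorem weight_ne_zero (a b : ℝ) {x : ℝ} (hx : x ∈ Ioo (-1 : ℝ) 1) :
    (((1 - x) ^ a * (1 + x) ^ b : ℝ) : ℂ) ≠ 0 := by
  have h1 : 0 < (1 - x) ^ a := Real.rpow_pos_of_pos (by linarith [hx.2]) _
  have h2 : 0 < (1 + x) ^ b := Real.rpow_pos_of_pos (by linarith [hx.1]) _
  exact_mod_cast (mul_pos h1 h2).ne'

theorem jacobi_congr (α β : ℝ) {f g : ℝ → ℂ} {x : ℝ} (h : f =ᶠ[𝓝 x] g) :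
    jacobi α β f =ᶠ[𝓝 x] jacobi α β g := by
  have h1 : (fun y => (((1 - y) ^ (α + 1) * (1 + y) ^ (β + 1) : ℝ) : ℂ) * deriv f y) =ᶠ[𝓝 x]
      fun y => (((1 - y) ^ (α + 1) * (1 + y) ^ (β + 1) : ℝ) : ℂ) * deriv g y :=
    h.deriv.mono fun y hy => by simp only [hy]
  filter_upwards [h1.deriv] with y hy
  simp only [jacobi, hy]

theorem jacobiPow_congr (α β : ℝ) (n : ℕ) {f g : ℝ → ℂ} {x : ℝ} (h : f =ᶠ[𝓝 x] g) :
    jacobiPow α β n f =ᶠ[𝓝 x] jacobiPow α β n g := by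
  induction n generalizing f g with
  | zero => exact h
  | succ n ih => exact ih (jacobi_congr α β h)

theorem jacobi_add (α β : ℝ) {f g : ℝ → ℂ} {x : ℝ} (hx : x ∈ Ioo (-1 : ℝ) 1)
    (hf : TimesDiffAt 2 f x) (hg : TimesDiffAt 2 g x) :
    jacobi α β (f + g) x = jacobi α β f x + jacobi α β g x := by
  have h1 : (fun y => (((1 - y) ^ (α + 1) * (1 + y) ^ (β + 1) : ℝ) : ℂ) * deriv (f + g) y) =ᶠ[𝓝 x]
      (fun y => (((1 - y) ^ (α + 1) * (1 + y) ^ (β + 1) : ℝ) : ℂ) * deriv f y) +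
      fun y => (((1 - y) ^ (α + 1) * (1 + y) ^ (β + 1) : ℝ) : ℂ) * deriv g y := by
    filter_upwards [hf.1, hg.1] with y hy1 hy2
    simp only [deriv_add hy1 hy2, Pi.add_apply, mul_add]
  have h2 : DifferentiableAt ℝ
      (fun y => (((1 - y) ^ (α + 1) * (1 + y) ^ (β + 1) : ℝ) : ℂ) * deriv f y) x :=
    TimesDiffAt.mul (m := 1) (contDiffAt_weight _ _ hx) hf.2
  have h3 : DifferentiableAt ℝ
      (fun y => (((1 - y) ^ (α + 1) * (1 + y) ^ (β + 1) : ℝ) : ℂ) * deriv g y) x :=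
    TimesDiffAt.mul (m := 1) (contDiffAt_weight _ _ hx) hg.2
  simp only [jacobi, h1.deriv_eq, deriv_add h2 h3]
  ring

theorem timesDiffAt_jacobi (α β : ℝ) {m : ℕ} {f : ℝ → ℂ} {x : ℝ} (hx : x ∈ Ioo (-1 : ℝ) 1)
    (hf : TimesDiffAt (m + 2) f x) : TimesDiffAt m (jacobi α β f) x := by
  rcases m with _ | m
  · trivial
  have h1 : TimesDiffAt (m + 2)
      (fun y => (((1 - y) ^ (α + 1) * (1 + y) ^ (β + 1) : ℝ) : ℂ) * deriv f y) x :=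
    TimesDiffAt.mul (contDiffAt_weight _ _ hx) hf.2
  have h2 := TimesDiffAt.mul
    ((contDiffAt_weight α β hx).inv (weight_ne_zero α β hx)).neg h1.2
  refine h2.congr (Eventually.of_forall fun y => ?_)
  simp only [jacobi, neg_mul, Pi.inv_apply]

theorem jacobiPow_add (α β : ℝ) {n : ℕ} {f g : ℝ → ℂ} {x : ℝ} (hx : x ∈ Ioo (-1 : ℝ) 1)
    (hf : TimesDiffAt (2 * n) f x) (hg : TimesDiffAt (2 * n) g x) :
    jacobiPow α β n (f + g) x = jacobiPow α β n f x + jacobiPow α β n g x := by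
  induction n generalizing f g with
  | zero => rfl
  | succ n ih =>
    change jacobiPow α β n (jacobi α β (f + g)) x =
      jacobiPow α β n (jacobi α β f) x + jacobiPow α β n (jacobi α β g) x
    rw [← ih (timesDiffAt_jacobi α β hx hf) (timesDiffAt_jacobi α β hx hg)]
    rcases n with _ | n
    · exact jacobi_add α β hx hf hg
    · refine (jacobiPow_congr α β (n + 1) ?_).self_of_nhds
      have hev : ∀ {k : ℕ} {h : ℝ → ℂ}, TimesDiffAt (k + 3) h x →
          ∀ᶠ y in 𝓝 x, TimesDiffAt 2 h y := by
        intro k h hh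
        have h2 : ∀ᶠ y in 𝓝 x, DifferentiableAt ℝ (deriv h) y := hh.2.1
        filter_upwards [hh.1.eventually_nhds, h2] with y hy1 hy2
        exact ⟨hy1, hy2⟩
      filter_upwards [hev (k := 2 * n + 1) hf, hev (k := 2 * n + 1) hg, isOpen_Ioo.mem_nhds hx]
        with y h1 h2 h3
      exact jacobi_add α β h3 h1 h2

theorem jacobi_smul (α β : ℝ) (c : ℂ) (f : ℝ → ℂ) : jacobi α β (c • f) = c • jacobi α β f := by
  funext x
  have h : (fun y => (((1 - y) ^ (α + 1) * (1 + y) ^ (β + 1) : ℝ) : ℂ) * deriv (c • f) y) =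
      fun y => c * ((((1 - y) ^ (α + 1) * (1 + y) ^ (β + 1) : ℝ) : ℂ) * deriv f y) := by
    funext y
    have : deriv (c • f) y = c * deriv f y := deriv_const_mul_field c
    rw [this]
    ring
  simp only [jacobi, h, deriv_const_mul_field, Pi.smul_apply, smul_eq_mul]
  ring

theorem jacobiPow_smul (α β : ℝ) (n : ℕ) (c : ℂ) (f : ℝ → ℂ) :
    jacobiPow α β n (c • f) = c • jacobiPow α β n f := by
  induction n generalizing f with
  | zero => rfl
  | succ n ih =>
    change jacobiPow α β n (jacobi α β (c • f)) = c • jacobiPow α β n (jacobi α β f)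
    rw [jacobi_smul, ih]

theorem LocallyAC.congr {f g : ℝ → ℂ} (hf : LocallyAC f) (h : EqOn f g (Ioo (-1 : ℝ) 1)) :
    LocallyAC g := by
  intro a b ha hab hb
  have h1 := hf a b ha hab hb
  rw [absolutelyContinuousOnInterval_iff] at h1 ⊢
  intro ε hε
  obtain ⟨δ, hδ, H⟩ := h1 ε hε
  refine ⟨δ, hδ, fun E hE hlt => ?_⟩
  have hsub : uIcc a b ⊆ Ioo (-1 : ℝ) 1 := by
    rw [uIcc_of_le hab]
    exact fun y hy => ⟨by linarith [hy.1], by linarith [hy.2]⟩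
  refine lt_of_eq_of_lt (Finset.sum_congr rfl fun i hi => ?_) (H E hE hlt)
  rw [h (hsub (hE.1 i hi).1), h (hsub (hE.1 i hi).2)]

theorem IsRegular.contDiffAt {n : ℕ} {f : ℝ → ℂ} (hf : IsRegular n f) {k : ℕ} (hk : k < 2 * n)
    {x : ℝ} (hx : x ∈ Ioo (-1 : ℝ) 1) : ContDiffAt ℝ k f x :=
  (hf.1.contDiffAt (isOpen_Ioo.mem_nhds hx)).of_le (by exact_mod_cast (by omega : k ≤ 2 * n - 1))

theorem IsRegular.add {n : ℕ} {f g : ℝ → ℂ} (hf : IsRegular n f) (hg : IsRegular n g) :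
    IsRegular n (f + g) := by
  refine ⟨hf.1.add hg.1, fun k hk => ?_⟩
  have h : LocallyAC (iteratedDeriv k f + iteratedDeriv k g) := fun a b ha hab hb =>
    (hf.2 k hk a b ha hab hb).add (hg.2 k hk a b ha hab hb)
  refine h.congr fun x hx => ?_
  exact (iteratedDeriv_add (hf.contDiffAt hk hx) (hg.contDiffAt hk hx)).symm

theorem IsRegular.smul {n : ℕ} {f : ℝ → ℂ} (c : ℂ) (hf : IsRegular n f) :
    IsRegular n (c • f) := by
  refine ⟨contDiffOn_const.smul hf.1, fun k hk => ?_⟩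
  have h : LocallyAC (c • iteratedDeriv k f) := fun a b ha hab hb =>
    (hf.2 k hk a b ha hab hb).const_smul c
  refine h.congr fun x hx => ?_
  exact (iteratedDeriv_const_smul (hf.contDiffAt hk hx) c).symm

theorem isRegular_zero (n : ℕ) : IsRegular n 0 := by
  refine ⟨contDiffOn_const, fun k _ a b _ _ _ => ?_⟩
  have : ContDiff ℝ 1 (iteratedDeriv k (0 : ℝ → ℂ)) := by
    rw [iteratedDeriv_eq_iterate]
    exact ContDiff.iterate_deriv' 1 k contDiff_const
  exact this.contDiffOn.absolutelyContinuousOnInterval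

theorem weightMeasure_ac (α β : ℝ) :
    weightMeasure α β ≪ volume.restrict (Ioo (-1 : ℝ) 1) :=
  withDensity_absolutelyContinuous _ _

theorem ac_weightMeasure (α β : ℝ) :
    volume.restrict (Ioo (-1 : ℝ) 1) ≪ weightMeasure α β := by
  refine withDensity_absolutelyContinuous' (by fun_prop) ?_
  filter_upwards [ae_restrict_mem measurableSet_Ioo] with x hx
  have h1 : 0 < (1 - x) ^ α := Real.rpow_pos_of_pos (by linarith [hx.2]) _
  have h2 : 0 < (1 + x) ^ β := Real.rpow_pos_of_pos (by linarith [hx.1]) _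
  simpa using mul_pos h1 h2

/-! ### Maximal and minimal operators, defect spaces -/

/-- The graph of the maximal operator of `ℓⁿ`: the pairs `(f, ℓⁿ[f])` in `L² × L²` such that
`f, f', …, f ^ (2 n - 1)` are locally absolutely continuous on `(-1, 1)`. -/
noncomputable def maxGraph (α β : ℝ) (n : ℕ) : Submodule ℂ (L2 α β × L2 α β) where
  carrier := {p | ∃ f : ℝ → ℂ, IsRegular n f ∧ p.1 =ᵐ[weightMeasure α β] f ∧
    p.2 =ᵐ[weightMeasure α β] jacobiPow α β n f}
  zero_mem' := by
    refine ⟨0, isRegular_zero n, Lp.coeFn_zero _ _ _, ?_⟩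
    have h : jacobiPow α β n 0 = 0 := by
      have := jacobiPow_smul α β n 0 0
      simpa using this
    rw [h]
    exact Lp.coeFn_zero _ _ _
  add_mem' := by
    rintro ⟨u₁, v₁⟩ ⟨u₂, v₂⟩ ⟨f, hf, hu₁, hv₁⟩ ⟨g, hg, hu₂, hv₂⟩
    refine ⟨f + g, hf.add hg, (Lp.coeFn_add _ _).trans (hu₁.add hu₂), ?_⟩
    refine (Lp.coeFn_add _ _).trans ((hv₁.add hv₂).trans ?_)
    refine (weightMeasure_ac α β).ae_le ?_
    filter_upwards [hf.ae_timesDiffAt, hg.ae_timesDiffAt, ae_restrict_mem measurableSet_Ioo]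
      with x h1 h2 h3
    exact (jacobiPow_add α β h3 h1 h2).symm
  smul_mem' := by
    rintro c ⟨u, v⟩ ⟨f, hf, hu, hv⟩
    refine ⟨c • f, hf.smul c, (Lp.coeFn_smul _ _).trans (hu.const_smul c), ?_⟩
    rw [jacobiPow_smul]
    exact (Lp.coeFn_smul _ _).trans (hv.const_smul c)

/-- The maximal graph is single-valued, so that it is indeed the graph of an operator. -/
theorem maxGraph_single_valued (α β : ℝ) {n : ℕ} (p : L2 α β × L2 α β)
    (hp : p ∈ maxGraph α β n) (h0 : p.1 = 0) : p.2 = 0 := by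
  obtain ⟨f, hf, hu, hv⟩ := hp
  have h1 : f =ᵐ[volume.restrict (Ioo (-1 : ℝ) 1)] (0 : ℝ → ℂ) := by
    refine (ac_weightMeasure α β).ae_le ?_
    rw [h0] at hu
    exact hu.symm.trans (Lp.coeFn_zero _ _ _)
  have h2 : EqOn f 0 (Ioo (-1 : ℝ) 1) :=
    Measure.eqOn_open_of_ae_eq h1 isOpen_Ioo hf.1.continuousOn continuousOn_const
  have hz : jacobiPow α β n 0 = 0 := by
    have := jacobiPow_smul α β n 0 0
    simpa using this
  refine Lp.ext (hv.trans (EventuallyEq.trans ?_ (Lp.coeFn_zero _ _ _).symm))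
  refine (weightMeasure_ac α β).ae_le ?_
  filter_upwards [ae_restrict_mem measurableSet_Ioo] with x hx
  have h3 : f =ᶠ[𝓝 x] 0 := by
    filter_upwards [isOpen_Ioo.mem_nhds hx] with y hy
    exact h2 hy
  rw [(jacobiPow_congr α β n h3).self_of_nhds, hz]

/-- The maximal operator of `ℓⁿ`; its domain is the maximal domain. -/
noncomputable def maxOp (α β : ℝ) (n : ℕ) : L2 α β →ₗ.[ℂ] L2 α β :=
  (maxGraph α β n).toLinearPMap

/-- The sesquilinear form `[f, g]ₙ` between the endpoints `-1` and `1`, given by Green's formula: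
`∫ (ℓⁿ[f] conj g - conj (ℓⁿ[g]) f) (1 - x) ^ α (1 + x) ^ β dx` over `(-1, 1)`, that is
`⟨ℓⁿ f, g⟩ - ⟨f, ℓⁿ g⟩`. Mathlib's inner product `⟪a, b⟫ = ∫ conj a * b` is linear in its
second argument. -/
noncomputable def greenForm (α β : ℝ) (n : ℕ) (f g : (maxOp α β n).domain) : ℂ :=
  ⟪(g : L2 α β), maxOp α β n f⟫_ℂ - ⟪maxOp α β n g, (f : L2 α β)⟫_ℂ

/-- The minimal domain of `ℓⁿ`: the `f` in the maximal domain with `[f, g]ₙ = 0` for all `g` in the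
maximal domain. -/
noncomputable def minDomain (α β : ℝ) (n : ℕ) : Submodule ℂ (L2 α β) where
  carrier := {u | ∃ hu : u ∈ (maxOp α β n).domain,
    ∀ g : (maxOp α β n).domain, greenForm α β n ⟨u, hu⟩ g = 0}
  zero_mem' := ⟨Submodule.zero_mem _, fun g => by
    have h : (⟨0, Submodule.zero_mem _⟩ : (maxOp α β n).domain) = 0 := rfl
    simp [greenForm, h, LinearPMap.map_zero]⟩
  add_mem' := by
    rintro u v ⟨hu, hu'⟩ ⟨hv, hv'⟩
    refine ⟨Submodule.add_mem _ hu hv, fun g => ?_⟩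
    have h : (⟨u + v, Submodule.add_mem _ hu hv⟩ : (maxOp α β n).domain) = ⟨u, hu⟩ + ⟨v, hv⟩ := rfl
    have h1 := hu' g
    have h2 := hv' g
    simp only [greenForm] at h1 h2 ⊢
    rw [h, LinearPMap.map_add, inner_add_right, inner_add_right]
    linear_combination h1 + h2
  smul_mem' := by
    rintro c u ⟨hu, hu'⟩
    refine ⟨Submodule.smul_mem _ c hu, fun g => ?_⟩
    have h : (⟨c • u, Submodule.smul_mem _ c hu⟩ : (maxOp α β n).domain) = c • ⟨u, hu⟩ := rfl
    have h1 := hu' g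
    simp only [greenForm] at h1 ⊢
    rw [h, LinearPMap.map_smul, inner_smul_right, inner_smul_right]
    linear_combination c * h1

/-- The minimal operator of `ℓⁿ`: the restriction of the maximal operator to the minimal domain. -/
noncomputable def minOp (α β : ℝ) (n : ℕ) : L2 α β →ₗ.[ℂ] L2 α β :=
  (maxOp α β n).domRestrict (minDomain α β n)

/-- The defect space `{f ∈ D(A*) : A* f = z f}` of an operator `A`; it is the positive defect space
for `z = i` and the negative one for `z = -i`. -/
noncomputable def defectSpace {H : Type*} [NormedAddCommGroup H] [InnerProductSpace ℂ H]
    [CompleteSpace H] (A : H →ₗ.[ℂ] H) (z : ℂ) : Submodule ℂ H where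
  carrier := {f | ∃ hf : f ∈ A.adjoint.domain, A.adjoint ⟨f, hf⟩ = z • f}
  zero_mem' := ⟨Submodule.zero_mem _, by
    rw [smul_zero]
    exact LinearPMap.map_zero _⟩
  add_mem' := by
    rintro u v ⟨hu, hu'⟩ ⟨hv, hv'⟩
    refine ⟨Submodule.add_mem _ hu hv, ?_⟩
    rw [smul_add, ← hu', ← hv', ← LinearPMap.map_add]
    rfl
  smul_mem' := by
    rintro c u ⟨hu, hu'⟩
    refine ⟨Submodule.smul_mem _ c hu, ?_⟩
    rw [smul_comm, ← hu', ← LinearPMap.map_smul]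
    rfl

/-- The positive defect space of the minimal operator of `ℓⁿ`. -/
noncomputable def defectPlus (α β : ℝ) (n : ℕ) : Submodule ℂ (L2 α β) :=
  defectSpace (minOp α β n) Complex.I

/-- The negative defect space of the minimal operator of `ℓⁿ`. -/
noncomputable def defectMinus (α β : ℝ) (n : ℕ) : Submodule ℂ (L2 α β) :=
  defectSpace (minOp α β n) (-Complex.I)

/-- The sum of the two defect spaces of the minimal operator of `ℓⁿ`. -/
noncomputable def defectSum (α β : ℝ) (n : ℕ) : Submodule ℂ (L2 α β) :=
  defectPlus α β n ⊔ defectMinus α β n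

/-! ### The endpoint functions and their spans -/

/-- `f` is smooth on `(-1, 1)`, equal to `l` near `-1` and equal to `r` near `1`. -/
def HasEndpointBehavior (l r : ℝ → ℝ) (f : ℝ → ℂ) : Prop :=
  ContDiffOn ℝ ∞ f (Ioo (-1 : ℝ) 1) ∧
    (∀ᶠ x in 𝓝[>] (-1 : ℝ), f x = (l x : ℂ)) ∧ ∀ᶠ x in 𝓝[<] (1 : ℝ), f x = (r x : ℂ)

/-- `f` is a choice of `φ_j⁺`: `(1 - x) ^ j` near `1` and `0` near `-1`. -/
def IsPhiPlus (j : ℕ) (f : ℝ → ℂ) : Prop :=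
  HasEndpointBehavior (fun _ => 0) (fun x => (1 - x) ^ j) f

/-- `f` is a choice of `φ_j⁻`: `0` near `1` and `(1 + x) ^ j` near `-1`. -/
def IsPhiMinus (j : ℕ) (f : ℝ → ℂ) : Prop :=
  HasEndpointBehavior (fun x => (1 + x) ^ j) (fun _ => 0) f

/-- `f` is a choice of `ψ_j⁺`: `(1 - x) ^ (-α + j)` near `1` and `0` near `-1`. -/
def IsPsiPlus (α : ℝ) (j : ℕ) (f : ℝ → ℂ) : Prop :=
  HasEndpointBehavior (fun _ => 0) (fun x => (1 - x) ^ (-α + (j : ℝ))) f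

/-- `f` is a choice of `ψ_j⁻`: `0` near `1` and `(1 + x) ^ (-β + j)` near `-1`. -/
def IsPsiMinus (β : ℝ) (j : ℕ) (f : ℝ → ℂ) : Prop :=
  HasEndpointBehavior (fun x => (1 + x) ^ (-β + (j : ℝ))) (fun _ => 0) f

/-- The span in `L²` of the classes of the functions `φ_j` and `ψ_j`, `j < n`. -/
noncomputable def endpointSpan (α β : ℝ) {n : ℕ} (φ ψ : Fin n → ℝ → ℂ) : Submodule ℂ (L2 α β) :=
  Submodule.span ℂ {u | ∃ j, u =ᵐ[weightMeasure α β] φ j ∨ u =ᵐ[weightMeasure α β] ψ j}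

end JacobiPowers

/-! Everything reduces to linear algebra once `ℓ` is inverted. The solutions of `ℓ[f] = 0` are
spanned by `1` and `P = secondSol`, with `P' = (1 - x) ^ (-α - 1) (1 + x) ^ (-β - 1)`. Since `0 < α,
β < 1`, both lie in `L²`: each endpoint is in the limit circle case. Let `K` be their span, `w` the
weight, and `V h (x) = ∫_{-1}^x (P(s) - P(x)) h(s) w(s) ds`, so that `ℓ V = 1`. Then `(f, h)` is in
the maximal graph of `ℓⁿ` iff `f - Vⁿ h` lies in `K_n = K + V K + … + Vⁿ⁻¹ K` (`mem_maxGraph_iff`).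
If `h ⊥ K`, the integral may be taken from the other endpoint with the opposite sign, and Fubini
gives `⟪V h, u⟫ = ⟪h, V u⟫` (`symm_volterraOp`).

The rest of the operator theory follows from these facts. The minimal domain is `Vⁿ (K_nᗮ)`
(`mem_min_iff`) and `K_{2n}` is a complement of it in the maximal domain (`isCompl_aux`), so the
quotient has dimension `2n · 2 = 4n`. The minimal domain is dense, and the defect spaces are
eigenspaces of the maximal operator (`mem_defectSpace_iff`). By von Neumann's formula
(`min_sup_defect`) their sum is another complement, hence also `4n`-dimensional.

For the endpoint functions it remains to see that they are independent modulo the minimal domain. An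
element of that domain is `V g` with `g ⊥ K`, so it tends to `0` at both endpoints, which kills the
leading coefficients of its endpoint expansions. Applying `ℓ` lowers exponents by one with nonzero
factors, so induction on `n` kills all coefficients of order below `n` (`coeff_eq_zero`); these
coefficients determine a combination of the endpoint functions. Their image is thus a
`4n`-dimensional subspace of the `4n`-dimensional quotient, which the defect spaces fill. -/

namespace JacobiPowers

/-! ### Symmetric operators with a finite-dimensional kernel and a one-sided inverse -/

theorem map_mkQ_sup_eq {R M : Type*} [Ring R] [AddCommGroup M] [Module R M]
    (D C : Submodule R M) : (D ⊔ C).map D.mkQ = C.map D.mkQ := by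
  rw [Submodule.map_sup, Submodule.mkQ_map_self, bot_sup_eq]

theorem finrank_map_mkQ {R M : Type*} [Ring R] [AddCommGroup M] [Module R M]
    {D C : Submodule R M} (h : Disjoint D C) :
    Module.finrank R (C.map D.mkQ) = Module.finrank R C := by
  have hinj : Function.Injective (D.mkQ ∘ₗ C.subtype) := by
    rw [← LinearMap.ker_eq_bot, LinearMap.ker_comp, Submodule.ker_mkQ,
      ← Submodule.disjoint_iff_comap_eq_bot]
    exact h.symm
  rw [← LinearMap.finrank_range_of_inj hinj, LinearMap.range_comp, Submodule.range_subtype]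

section Abstract

variable {H : Type*} [NormedAddCommGroup H] [InnerProductSpace ℂ H]

/-- The kernel of the `n`-th power of an operator with kernel `K` and right inverse `V`. -/
def kerPow (V : H →ₗ[ℂ] H) (K : Submodule ℂ H) : ℕ → Submodule ℂ H
  | 0 => ⊥
  | n + 1 => K ⊔ (kerPow V K n).map V

/-- `V` is a right inverse of an operator with kernel `K`, and it is symmetric on `Kᗮ`. -/
structure SymmetricRightInverse (V : H →ₗ[ℂ] H) (K : Submodule ℂ H) : Prop where
  symm : ∀ h ∈ Kᗮ, ∀ u, ⟪V h, u⟫_ℂ = ⟪h, V u⟫_ℂ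
  -- The only trace of an operator `A` with kernel `K` and `A V = 1`: if `V h ∈ K`, then `h = A (V
  -- h) = 0`.
  inj : ∀ h, V h ∈ K → h = 0

variable {V : H →ₗ[ℂ] H} {K : Submodule ℂ H}

theorem kerPow_one : kerPow V K 1 = K := by simp [kerPow]

theorem le_kerPow_succ (n : ℕ) : K ≤ kerPow V K (n + 1) := le_sup_left

theorem map_kerPow_le (n : ℕ) {k : H} (hk : k ∈ kerPow V K n) : V k ∈ kerPow V K (n + 1) :=
  (le_sup_right : _ ≤ K ⊔ (kerPow V K n).map V) (Submodule.mem_map_of_mem hk)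

/-- With `m = n` this splits `K_{2n}` into `K_n` and `Vⁿ K_n`, the form in which it is compared with
the minimal domain `Vⁿ (K_nᗮ)`. -/
theorem kerPow_add (m n : ℕ) :
    kerPow V K (m + n) = kerPow V K m ⊔ (kerPow V K n).map (V ^ m) := by
  induction m with
  | zero => simp [kerPow, Module.End.one_eq_id]
  | succ m ih =>
    rw [show m + 1 + n = (m + n) + 1 by omega, kerPow, ih, Submodule.map_sup, ← sup_assoc, kerPow,
      pow_succ', Module.End.mul_eq_comp, Submodule.map_comp]

instance kerPow_finiteDimensional [FiniteDimensional ℂ K] (n : ℕ) :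
    FiniteDimensional ℂ (kerPow V K n) := by
  induction n with
  | zero => exact inferInstanceAs (FiniteDimensional ℂ (⊥ : Submodule ℂ H))
  | succ n ih => exact inferInstanceAs
      (FiniteDimensional ℂ (K ⊔ (kerPow V K n).map V : Submodule ℂ H))

namespace SymmetricRightInverse


/-- The `n`-th power of the underlying operator sends `Vⁿ h` to `h` and annihilates `kerPow V K n`.
Without that operator at hand, `inj` peels off one factor at a time. -/
theorem eq_zero_of_pow_mem (hV : SymmetricRightInverse V K) (n : ℕ) {h : H}
    (hh : (V ^ n) h ∈ kerPow V K n) : h = 0 := by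
  induction n with
  | zero => simpa [kerPow] using hh
  | succ n ih =>
    obtain ⟨k, hk, y, hy, hky⟩ := Submodule.mem_sup.1 hh
    obtain ⟨k', hk', rfl⟩ := Submodule.mem_map.1 hy
    have h1 : V ((V ^ n) h - k') = k := by
      rw [map_sub, sub_eq_iff_eq_add, hky, pow_succ', Module.End.mul_apply]
    have h2 := hV.inj _ (h1 ▸ hk)
    rw [sub_eq_zero] at h2
    exact ih (h2 ▸ hk')

theorem injective (hV : SymmetricRightInverse V K) : Function.Injective V :=
  (injective_iff_map_eq_zero V).2 fun h hh => hV.inj h (hh ▸ K.zero_mem)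

theorem finrank_kerPow [FiniteDimensional ℂ K] (hV : SymmetricRightInverse V K) (n : ℕ) :
    Module.finrank ℂ (kerPow V K n) = n * Module.finrank ℂ K := by
  induction n with
  | zero => rw [kerPow, finrank_bot, zero_mul]
  | succ n ih =>
    have h1 : K ⊓ (kerPow V K n).map V = ⊥ := by
      rw [Submodule.eq_bot_iff]
      rintro x ⟨hx, hx'⟩
      obtain ⟨k, -, rfl⟩ := Submodule.mem_map.1 hx'
      rw [hV.inj k hx, map_zero]
    have h2 := Submodule.finrank_sup_add_finrank_inf_eq K ((kerPow V K n).map V)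
    rw [h1, finrank_bot, add_zero,
      ← (Submodule.equivMapOfInjective V hV.injective _).finrank_eq, ih] at h2
    rw [kerPow, h2]
    ring

/-- Symmetry moves `V` onto the test vector, and `V K_n ⊆ K_{n+1}`. This keeps every iterate of `V`
inside `Kᗮ`, where the symmetry may be used again; `symm_pow` depends on it. -/
theorem apply_mem_orthogonal (hV : SymmetricRightInverse V K) (n : ℕ) {h : H}
    (hh : h ∈ (kerPow V K (n + 1))ᗮ) : V h ∈ (kerPow V K n)ᗮ := by
  rw [Submodule.mem_orthogonal']
  intro u hu
  rw [hV.symm h (Submodule.orthogonal_le (le_kerPow_succ n) hh)]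
  exact (Submodule.mem_orthogonal' _ _).1 hh _ (map_kerPow_le n hu)

theorem symm_pow (hV : SymmetricRightInverse V K) (n : ℕ) {h : H}
    (hh : h ∈ (kerPow V K n)ᗮ) (u : H) : ⟪(V ^ n) h, u⟫_ℂ = ⟪h, (V ^ n) u⟫_ℂ := by
  induction n generalizing h with
  | zero => simp
  | succ n ih =>
    rw [pow_succ, Module.End.mul_apply, ih (hV.apply_mem_orthogonal n hh),
      hV.symm h (Submodule.orthogonal_le (le_kerPow_succ n) hh), ← Module.End.mul_apply,
      ← pow_succ', pow_succ]

theorem symm_pow' (hV : SymmetricRightInverse V K) (n : ℕ) {h : H}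
    (hh : h ∈ (kerPow V K n)ᗮ) (u : H) : ⟪u, (V ^ n) h⟫_ℂ = ⟪(V ^ n) u, h⟫_ℂ := by
  rw [← inner_conj_symm, hV.symm_pow n hh, inner_conj_symm]

theorem pow_mem_orthogonal (hV : SymmetricRightInverse V K) (m n : ℕ) {h : H}
    (hh : h ∈ (kerPow V K (m + n))ᗮ) : (V ^ m) h ∈ (kerPow V K n)ᗮ := by
  induction m generalizing h with
  | zero => simpa using hh
  | succ m ih =>
    rw [pow_succ, Module.End.mul_apply]
    exact ih (hV.apply_mem_orthogonal (m + n) (by rwa [show m + n + 1 = m + 1 + n by omega]))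

end SymmetricRightInverse

/-- The maximal operator `A`, given by the right inverse `V ^ n` and the kernel `kerPow V K n`, and
the domain `D` of the minimal operator. -/
structure IsMaxMinPair (V : H →ₗ[ℂ] H) (K : Submodule ℂ H) (n : ℕ) (A : H →ₗ.[ℂ] H)
    (D : Submodule ℂ H) : Prop where
  mem_graph : ∀ f h, (f, h) ∈ A.graph ↔ f - (V ^ n) h ∈ kerPow V K n
  mem_min : ∀ u, u ∈ D ↔ ∃ v, (u, v) ∈ A.graph ∧
    ∀ g w, (g, w) ∈ A.graph → ⟪g, v⟫_ℂ = ⟪w, u⟫_ℂ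

/-! ### Minimal domain, adjoint and von Neumann's formula for an abstract pair -/

namespace IsMaxMinPair

variable {n : ℕ} {A : H →ₗ.[ℂ] H} {D : Submodule ℂ H}

theorem pow_mem_graph (hA : IsMaxMinPair V K n A D) (h : H) : ((V ^ n) h, h) ∈ A.graph := by
  rw [hA.mem_graph]; simp

/-- Two kinds of test pairs suffice: `(k, 0)` with `k ∈ K_n` forces `v ⊥ K_n`, and `(Vⁿ w, w)` then
forces `u = Vⁿ v`. Together they span the graph. -/
theorem green_eq_zero_iff (hV : SymmetricRightInverse V K) (hA : IsMaxMinPair V K n A D)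
    (u v : H) : (∀ g w, (g, w) ∈ A.graph → ⟪g, v⟫_ℂ = ⟪w, u⟫_ℂ) ↔
      v ∈ (kerPow V K n)ᗮ ∧ u = (V ^ n) v := by
  constructor
  · intro H1
    have hv : v ∈ (kerPow V K n)ᗮ := by
      rw [Submodule.mem_orthogonal]
      intro k hk
      simpa using H1 k 0 ((hA.mem_graph _ _).2 (by simpa using hk))
    refine ⟨hv, ext_inner_left ℂ fun w => ?_⟩
    rw [hV.symm_pow' n hv, H1 _ _ (hA.pow_mem_graph w)]
  · rintro ⟨hv, rfl⟩ g w hg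
    rw [hA.mem_graph] at hg
    have h1 := (Submodule.mem_orthogonal _ _).1 hv _ hg
    rw [inner_sub_left, sub_eq_zero] at h1
    rw [h1, hV.symm_pow' n hv]

theorem mem_min_iff (hV : SymmetricRightInverse V K) (hA : IsMaxMinPair V K n A D) (u : H) :
    u ∈ D ↔ ∃ v ∈ (kerPow V K n)ᗮ, u = (V ^ n) v := by
  rw [hA.mem_min]
  constructor
  · rintro ⟨v, -, h⟩
    exact ⟨v, (hA.green_eq_zero_iff hV u v).1 h⟩
  · rintro ⟨v, h⟩
    exact ⟨v, h.2 ▸ hA.pow_mem_graph v, (hA.green_eq_zero_iff hV u v).2 h⟩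

theorem min_le (hA : IsMaxMinPair V K n A D) : D ≤ A.domain := by
  intro u hu
  obtain ⟨v, hv, -⟩ := (hA.mem_min u).1 hu
  exact LinearPMap.mem_domain_of_mem_graph hv

theorem mem_domain_iff (hA : IsMaxMinPair V K n A D) (f : H) :
    f ∈ A.domain ↔ ∃ h, f - (V ^ n) h ∈ kerPow V K n := by
  rw [LinearPMap.mem_domain_iff]
  simp only [hA.mem_graph]

theorem isCompl_aux [FiniteDimensional ℂ K] (hV : SymmetricRightInverse V K)
    (hA : IsMaxMinPair V K n A D) :
    Disjoint D (kerPow V K (n + n)) ∧ D ⊔ kerPow V K (n + n) = A.domain := by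
  constructor
  · rw [Submodule.disjoint_def]
    intro u hu hu'
    obtain ⟨v, hv, rfl⟩ := (hA.mem_min_iff hV u).1 hu
    rw [kerPow_add] at hu'
    obtain ⟨k, hk, y, hy, hky⟩ := Submodule.mem_sup.1 hu'
    obtain ⟨k', hk', rfl⟩ := Submodule.mem_map.1 hy
    have h1 : v - k' = 0 := by
      apply hV.eq_zero_of_pow_mem n
      rw [map_sub, ← hky, add_sub_cancel_right]
      exact hk
    rw [sub_eq_zero] at h1
    have h2 : v = 0 := inner_self_eq_zero.1 ((Submodule.mem_orthogonal _ _).1 hv v (h1 ▸ hk'))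
    rw [h2, map_zero]
  · apply le_antisymm
    · refine sup_le hA.min_le ?_
      rw [kerPow_add]
      refine sup_le (fun k hk => ?_) ?_
      · exact (hA.mem_domain_iff k).2 ⟨0, by simpa using hk⟩
      · rintro _ ⟨k, -, rfl⟩
        exact (hA.mem_domain_iff _).2 ⟨k, by simp⟩
    · intro f hf
      obtain ⟨h, hh⟩ := (hA.mem_domain_iff f).1 hf
      -- Of `h = k + v`, the part `v ⊥ K_n` gives the minimal-domain component `Vⁿ v`, while `Vⁿ k`
      -- goes into `K_{2n}`.
      obtain ⟨k, hk, v, hv, rfl⟩ := (kerPow V K n).exists_add_mem_mem_orthogonal h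
      rw [kerPow_add]
      rw [map_add] at hh
      rw [show f = (V ^ n) v + ((f - ((V ^ n) k + (V ^ n) v)) + (V ^ n) k) by abel]
      exact Submodule.add_mem_sup ((hA.mem_min_iff hV _).2 ⟨v, hv, rfl⟩)
        (Submodule.add_mem_sup hh (Submodule.mem_map_of_mem hk))

theorem finrank_eq_of_sup_eq {C C' : Submodule ℂ H} (h1 : Disjoint D C) (h1' : Disjoint D C')
    (h2 : D ⊔ C = D ⊔ C') : Module.finrank ℂ C = Module.finrank ℂ C' := by
  rw [← finrank_map_mkQ h1, ← finrank_map_mkQ h1', ← map_mkQ_sup_eq, h2, map_mkQ_sup_eq]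

theorem finrank_eq_of_isCompl [FiniteDimensional ℂ K] (hV : SymmetricRightInverse V K)
    (hA : IsMaxMinPair V K n A D) {C : Submodule ℂ H} (h1 : Disjoint D C)
    (h2 : D ⊔ C = A.domain) : Module.finrank ℂ C = 2 * n * Module.finrank ℂ K := by
  obtain ⟨h3, h4⟩ := hA.isCompl_aux hV
  rw [finrank_eq_of_sup_eq h1 h3 (h2.trans h4.symm), hV.finrank_kerPow]
  ring

variable [CompleteSpace H]

/-- If `y ⊥ Vⁿ (K_nᗮ)`, symmetry gives `Vⁿ y ∈ K_nᗮᗮ`. This is `K_n` by finite dimension, so `y =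
0`. -/
theorem dense_min [FiniteDimensional ℂ K] (hV : SymmetricRightInverse V K)
    (hA : IsMaxMinPair V K n A D) : Dense (D : Set H) := by
  rw [Submodule.dense_iff_topologicalClosure_eq_top, Submodule.topologicalClosure_eq_top_iff,
    Submodule.eq_bot_iff]
  intro y hy
  apply hV.eq_zero_of_pow_mem n
  rw [← Submodule.orthogonal_orthogonal (kerPow V K n), Submodule.mem_orthogonal]
  intro h hh
  rw [← hV.symm_pow n hh]
  exact (Submodule.mem_orthogonal _ _).1 hy _ ((hA.mem_min_iff hV _).2 ⟨h, hh, rfl⟩)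

theorem mem_defectSpace_iff [FiniteDimensional ℂ K] (hV : SymmetricRightInverse V K)
    (hA : IsMaxMinPair V K n A D) (z : ℂ) (f : H) :
    f ∈ defectSpace (A.domRestrict D) z ↔ (f, z • f) ∈ A.graph := by
  have hdom : (A.domRestrict D).domain = D := inf_eq_left.2 hA.min_le
  have hdense : Dense ((A.domRestrict D).domain : Set H) := by
    rw [hdom]; exact hA.dense_min hV
  -- The defining relation of the adjoint with value `z • f`. Tested on `Vⁿ h` with `h ⊥ K_n`, it
  -- says `f - Vⁿ (z • f) ∈ K_nᗮᗮ = K_n`.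
  have key : (∀ x : (A.domRestrict D).domain, ⟪z • f, (x : H)⟫_ℂ = ⟪f, A.domRestrict D x⟫_ℂ) ↔
      (f, z • f) ∈ A.graph := by
    have h1 : ∀ h (hh : h ∈ (kerPow V K n)ᗮ), ∃ hx : (V ^ n) h ∈ (A.domRestrict D).domain,
        A.domRestrict D ⟨_, hx⟩ = h := by
      intro h hh
      have hx : (V ^ n) h ∈ D := (hA.mem_min_iff hV _).2 ⟨h, hh, rfl⟩
      refine ⟨hdom.ge hx, ?_⟩
      have h2 := hA.pow_mem_graph h
      exact ((LinearPMap.image_iff (hA.min_le hx)).2 h2).symm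
    rw [hA.mem_graph]
    constructor
    · intro H1
      rw [← Submodule.orthogonal_orthogonal (kerPow V K n), Submodule.mem_orthogonal']
      intro h hh
      obtain ⟨hx, hx'⟩ := h1 h hh
      have h3 := H1 ⟨_, hx⟩
      rw [hx'] at h3
      rw [inner_sub_left, ← h3, sub_eq_zero, hV.symm_pow' n hh]
    · rintro H1 ⟨x, hx⟩
      obtain ⟨h, hh, rfl⟩ := (hA.mem_min_iff hV x).1 (hdom.le hx)
      obtain ⟨hx, hx'⟩ := h1 h hh
      rw [hx', hV.symm_pow' n hh]
      have := (Submodule.mem_orthogonal _ _).1 hh _ H1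
      rw [inner_sub_left, sub_eq_zero] at this
      exact this.symm
  rw [← key]
  constructor
  · rintro ⟨hf, hf'⟩ x
    rw [← hf']
    -- Density is essential: `LinearPMap.adjoint` takes the default value `0` when the domain is not
    -- dense.
    exact LinearPMap.adjoint_isFormalAdjoint hdense ⟨f, hf⟩ x
  · intro H1
    have hf : f ∈ (A.domRestrict D).adjoint.domain :=
      LinearPMap.mem_adjoint_domain_of_exists _ ⟨_, H1⟩
    exact ⟨hf, LinearPMap.adjoint_apply_eq hdense _ H1⟩

theorem disjoint_defectSpace [FiniteDimensional ℂ K] (hV : SymmetricRightInverse V K)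
    (hA : IsMaxMinPair V K n A D) :
    Disjoint (defectSpace (A.domRestrict D) Complex.I)
      (defectSpace (A.domRestrict D) (-Complex.I)) := by
  rw [Submodule.disjoint_def]
  intro f h1 h2
  rw [hA.mem_defectSpace_iff hV, hA.mem_graph, map_smul] at h1 h2
  apply hV.eq_zero_of_pow_mem n
  -- The difference of the two memberships is `-2i Vⁿ f`; the factor `i / 2` turns it into `Vⁿ f`.
  have h3 := (kerPow V K n).smul_mem (Complex.I / 2) (Submodule.sub_mem _ h1 h2)
  convert h3 using 1
  match_scalars
  · linear_combination Complex.I_mul_I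
  · ring

theorem defectSpace_le [FiniteDimensional ℂ K] (hV : SymmetricRightInverse V K)
    (hA : IsMaxMinPair V K n A D) (z : ℂ) : defectSpace (A.domRestrict D) z ≤ A.domain :=
  fun f hf => LinearPMap.mem_domain_of_mem_graph ((hA.mem_defectSpace_iff hV z f).1 hf)

theorem disjoint_min_defect [FiniteDimensional ℂ K] (hV : SymmetricRightInverse V K)
    (hA : IsMaxMinPair V K n A D) :
    Disjoint D (defectSpace (A.domRestrict D) Complex.I ⊔
      defectSpace (A.domRestrict D) (-Complex.I)) := by
  rw [Submodule.disjoint_def]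
  intro u hu hu'
  obtain ⟨f, hf, g, hg, rfl⟩ := Submodule.mem_sup.1 hu'
  rw [hA.mem_defectSpace_iff hV] at hf hg
  obtain ⟨v, hv, hgreen⟩ := (hA.mem_min _).1 hu
  have hv' : v = Complex.I • f + (-Complex.I) • g :=
    LinearPMap.mem_graph_snd_inj A hv (A.graph.add_mem hf hg) rfl
  subst hv'
  -- Pairing `u = f + g` with `f` and with `g` in Green's identity, the cross terms cancel and only
  -- `2i ‖f‖²` and `2i ‖g‖²` survive.
  have h1 := hgreen _ _ hf
  have h2 := hgreen _ _ hg
  simp only [inner_add_right, inner_smul_left, inner_smul_right, map_neg, Complex.conj_I] at h1 h2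
  have h3 : ⟪f, f⟫_ℂ = 0 := by
    have : (2 * Complex.I) * ⟪f, f⟫_ℂ = 0 := by linear_combination h1
    simpa using this
  have h4 : ⟪g, g⟫_ℂ = 0 := by
    have : (2 * Complex.I) * ⟪g, g⟫_ℂ = 0 := by linear_combination -h2
    simpa using this
  rw [inner_self_eq_zero.1 h3, inner_self_eq_zero.1 h4, add_zero]

/-- Von Neumann's formula. -/
theorem min_sup_defect [FiniteDimensional ℂ K] (hV : SymmetricRightInverse V K)
    (hA : IsMaxMinPair V K n A D) :
    D ⊔ (defectSpace (A.domRestrict D) Complex.I ⊔ defectSpace (A.domRestrict D) (-Complex.I)) =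
      A.domain := by
  refine le_antisymm (sup_le hA.min_le
    (sup_le (hA.defectSpace_le hV _) (hA.defectSpace_le hV _))) fun f hf => ?_
  obtain ⟨h, hfh⟩ := LinearPMap.mem_domain_iff.1 hf
  -- `W` is the graph of `A` rotated by a quarter turn, so that orthogonality to `W` is exactly
  -- Green's identity and `Wᗮ` is the graph of the minimal operator.
  let W : Submodule ℂ (WithLp 2 (H × H)) :=
    { carrier := {p | (p.snd, -p.fst) ∈ A.graph}
      zero_mem' := by
        have h0 : (((0 : WithLp 2 (H × H)).snd, -(0 : WithLp 2 (H × H)).fst) : H × H) = 0 := by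
          simp
        change _ ∈ A.graph
        rw [h0]
        exact A.graph.zero_mem
      add_mem' := fun {p q} hp hq => by
        simpa [add_comm] using A.graph.add_mem hp hq
      smul_mem' := fun c p hp => by simpa using A.graph.smul_mem c hp }
  have hWo : ∀ p : WithLp 2 (H × H), p ∈ Wᗮ ↔
      p.snd ∈ (kerPow V K n)ᗮ ∧ p.fst = (V ^ n) p.snd := by
    intro p
    rw [← hA.green_eq_zero_iff hV, Submodule.mem_orthogonal]
    constructor
    · intro H1 g w hg
      have := H1 (WithLp.toLp 2 (-w, g)) (by simpa [W] using hg)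
      rw [WithLp.prod_inner_apply] at this
      change ⟪-w, p.fst⟫_ℂ + ⟪g, p.snd⟫_ℂ = 0 at this
      rw [inner_neg_left] at this
      linear_combination this
    · intro H1 q hq
      have := H1 _ _ hq
      rw [inner_neg_left] at this
      rw [WithLp.prod_inner_apply]
      change ⟪q.fst, p.fst⟫_ℂ + ⟪q.snd, p.snd⟫_ℂ = 0
      linear_combination this
  -- An orthogonal complement is closed, so projecting onto `Wᗮ` requires no closedness of the graph
  -- of `A`.
  have : (Wᗮ).HasOrthogonalProjection :=
    @Submodule.HasOrthogonalProjection.ofCompleteSpace _ _ _ _ _ _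
      (Submodule.isClosed_orthogonal W).completeSpace_coe
  obtain ⟨s, hs, q, hq, hsq⟩ := (Wᗮ).exists_add_mem_mem_orthogonal (WithLp.toLp 2 (f, h))
  rw [hWo] at hs
  have hf' : f = s.fst + q.fst := congrArg WithLp.fst hsq
  have hh : h = s.snd + q.snd := congrArg WithLp.snd hsq
  have hq1 : q.fst - (V ^ n) q.snd ∈ kerPow V K n := by
    have := (hA.mem_graph _ _).1 hfh
    rw [hf', hh, hs.2, map_add] at this
    convert this using 1
    abel
  -- Write `q = (a, b)`. Before this step `A a = b`; orthogonality to the minimal graph now gives `A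
  -- b = -a`.
  have hq2 : q.snd + (V ^ n) q.fst ∈ kerPow V K n := by
    rw [← Submodule.orthogonal_orthogonal (kerPow V K n), Submodule.mem_orthogonal]
    intro v hv
    have := (Submodule.mem_orthogonal _ _).1 hq (WithLp.toLp 2 ((V ^ n) v, v))
      ((hWo _).2 ⟨hv, rfl⟩)
    rw [WithLp.prod_inner_apply] at this
    change ⟪(V ^ n) v, q.fst⟫_ℂ + ⟪v, q.snd⟫_ℂ = 0 at this
    rw [inner_add_right, ← hV.symm_pow n hv]
    linear_combination this
  rw [hf']
  refine Submodule.add_mem_sup ((hA.mem_min_iff hV _).2 ⟨_, hs⟩) ?_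
  have hI := Complex.I_mul_I
  -- From `A a = b` and `A b = -a`, the vectors `a - i b` and `a + i b` are eigenvectors for `i` and
  -- `-i`.
  rw [show q.fst = (1 / 2 : ℂ) • (q.fst - Complex.I • q.snd) +
    (1 / 2 : ℂ) • (q.fst + Complex.I • q.snd) by match_scalars <;> ring]
  refine Submodule.add_mem_sup (Submodule.smul_mem _ _ ?_) (Submodule.smul_mem _ _ ?_)
  · rw [hA.mem_defectSpace_iff hV, hA.mem_graph]
    convert Submodule.sub_mem _ hq1 (Submodule.smul_mem _ Complex.I hq2) using 1
    simp only [map_smul, map_sub]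
    match_scalars <;> first | ring1 | linear_combination hI
  · rw [hA.mem_defectSpace_iff hV, hA.mem_graph]
    convert Submodule.add_mem _ hq1 (Submodule.smul_mem _ Complex.I hq2) using 1
    simp only [map_smul, map_add]
    match_scalars <;> first | ring1 | linear_combination hI

end IsMaxMinPair
end Abstract

/-! ### Functions whose derivatives up to some order are locally absolutely continuous -/

/-- The derivatives of `f` of order at most `m` are locally absolutely continuous on `(-1, 1)`. -/
def ACDeriv : ℕ → (ℝ → ℂ) → Prop
  | 0, f => LocallyAC f
  | m + 1, f => DifferentiableOn ℝ f (Ioo (-1 : ℝ) 1) ∧ ACDeriv m (deriv f)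

theorem LocallyAC.continuousOn {f : ℝ → ℂ} (hf : LocallyAC f) :
    ContinuousOn f (Ioo (-1 : ℝ) 1) := by
  intro x hx
  obtain ⟨a, ha, hax⟩ := exists_between hx.1
  obtain ⟨b, hxb, hb⟩ := exists_between hx.2
  have h1 := (hf a b ha (hax.trans hxb).le hb).continuousOn
  rw [uIcc_of_le (hax.trans hxb).le] at h1
  exact (h1.continuousAt (Icc_mem_nhds hax hxb)).continuousWithinAt

theorem locallyAC_of_contDiffOn {f : ℝ → ℂ} (hf : ContDiffOn ℝ 1 f (Ioo (-1 : ℝ) 1)) :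
    LocallyAC f := by
  intro a b ha hab hb
  refine (hf.mono ?_).absolutelyContinuousOnInterval
  rw [uIcc_of_le hab]
  exact fun y hy => ⟨by linarith [hy.1], by linarith [hy.2]⟩

theorem EqOn.deriv_eqOn_Ioo {f g : ℝ → ℂ} (h : EqOn f g (Ioo (-1 : ℝ) 1)) :
    EqOn (deriv f) (deriv g) (Ioo (-1 : ℝ) 1) := fun x hx =>
  EventuallyEq.deriv_eq (by filter_upwards [isOpen_Ioo.mem_nhds hx] with y hy using h hy)

theorem ACDeriv.congr {m : ℕ} {f g : ℝ → ℂ} (hf : ACDeriv m f)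
    (h : EqOn f g (Ioo (-1 : ℝ) 1)) : ACDeriv m g := by
  induction m generalizing f g with
  | zero => exact LocallyAC.congr hf h
  | succ m ih => exact ⟨hf.1.congr fun x hx => (h hx).symm, ih hf.2 (EqOn.deriv_eqOn_Ioo h)⟩

theorem ACDeriv.continuousOn : ∀ {m : ℕ} {f : ℝ → ℂ}, ACDeriv m f →
    ContinuousOn f (Ioo (-1 : ℝ) 1)
  | 0, _, h => LocallyAC.continuousOn h
  | _ + 1, _, h => h.1.continuousOn

theorem ACDeriv.of_succ : ∀ {m : ℕ} {f : ℝ → ℂ}, ACDeriv (m + 1) f → ACDeriv m f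
  | 0, _, h => locallyAC_of_contDiffOn <| by
    have h1 : ((0 : WithTop ℕ∞) + 1) = 1 := zero_add 1
    rw [← h1, contDiffOn_succ_iff_deriv_of_isOpen isOpen_Ioo]
    exact ⟨h.1, by simp, contDiffOn_zero.2 h.2.continuousOn⟩
  | _ + 1, _, h => ⟨h.1, h.2.of_succ⟩

theorem ACDeriv.of_le {m k : ℕ} {f : ℝ → ℂ} (hk : k ≤ m) (hf : ACDeriv m f) : ACDeriv k f := by
  induction hk with
  | refl => exact hf
  | step _ ih => exact ih hf.of_succ

theorem differentiableAt_of_Ioo {f : ℝ → ℂ} (hf : DifferentiableOn ℝ f (Ioo (-1 : ℝ) 1)) {x : ℝ}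
    (hx : x ∈ Ioo (-1 : ℝ) 1) : DifferentiableAt ℝ f x :=
  hf.differentiableAt (isOpen_Ioo.mem_nhds hx)

theorem ACDeriv.add {m : ℕ} {f g : ℝ → ℂ} (hf : ACDeriv m f) (hg : ACDeriv m g) :
    ACDeriv m (fun x => f x + g x) := by
  induction m generalizing f g with
  | zero => exact fun a b ha hab hb => (hf a b ha hab hb).add (hg a b ha hab hb)
  | succ m ih =>
    refine ⟨hf.1.add hg.1, (ih hf.2 hg.2).congr fun x hx => ?_⟩
    exact (deriv_fun_add (differentiableAt_of_Ioo hf.1 hx) (differentiableAt_of_Ioo hg.1 hx)).symm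

theorem contDiffOn_deriv {c : ℝ → ℂ} (hc : ContDiffOn ℝ ∞ c (Ioo (-1 : ℝ) 1)) :
    ContDiffOn ℝ ∞ (deriv c) (Ioo (-1 : ℝ) 1) :=
  hc.deriv_of_isOpen isOpen_Ioo (by simp)

theorem acDeriv_of_contDiffOn (m : ℕ) {c : ℝ → ℂ} (hc : ContDiffOn ℝ ∞ c (Ioo (-1 : ℝ) 1)) :
    ACDeriv m c := by
  induction m generalizing c with
  | zero => exact locallyAC_of_contDiffOn (hc.of_le (by exact_mod_cast le_top))
  | succ m ih => exact ⟨hc.differentiableOn (by simp), ih (contDiffOn_deriv hc)⟩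

theorem ACDeriv.mul {m : ℕ} {c f : ℝ → ℂ} (hc : ContDiffOn ℝ ∞ c (Ioo (-1 : ℝ) 1))
    (hf : ACDeriv m f) : ACDeriv m (fun x => c x * f x) := by
  induction m generalizing c f with
  | zero =>
    exact fun a b ha hab hb => (acDeriv_of_contDiffOn 0 hc a b ha hab hb).smul (hf a b ha hab hb)
  | succ m ih =>
    have hcd := hc.differentiableOn (by simp)
    refine ⟨hcd.mul hf.1, ((ih (contDiffOn_deriv hc) hf.of_succ).add
      (ih hc hf.2)).congr fun x hx => ?_⟩
    exact (deriv_fun_mul (differentiableAt_of_Ioo hcd hx) (differentiableAt_of_Ioo hf.1 hx)).symm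

theorem acDeriv_iff {m : ℕ} {f : ℝ → ℂ} : ACDeriv m f ↔
    ContDiffOn ℝ m f (Ioo (-1 : ℝ) 1) ∧ ∀ k < m + 1, LocallyAC (iteratedDeriv k f) := by
  induction m generalizing f with
  | zero =>
    constructor
    · intro h
      refine ⟨contDiffOn_zero.2 h.continuousOn, fun k hk => ?_⟩
      obtain rfl : k = 0 := by omega
      rw [iteratedDeriv_zero]
      exact h
    · intro h
      have h1 := h.2 0 (by omega)
      rw [iteratedDeriv_zero] at h1
      exact h1
  | succ m ih =>
    have hcd : ContDiffOn ℝ ((m + 1 : ℕ) : WithTop ℕ∞) f (Ioo (-1 : ℝ) 1) ↔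
        DifferentiableOn ℝ f (Ioo (-1 : ℝ) 1) ∧
          ContDiffOn ℝ m (deriv f) (Ioo (-1 : ℝ) 1) := by
      push_cast
      rw [contDiffOn_succ_iff_deriv_of_isOpen isOpen_Ioo]
      simp
    rw [hcd]
    constructor
    · intro h
      have h2 := ih.1 h.2
      refine ⟨⟨h.1, h2.1⟩, fun k hk => ?_⟩
      rcases k with _ | k
      · rw [iteratedDeriv_zero]
        exact h.of_le (Nat.zero_le _)
      · rw [iteratedDeriv_succ']
        exact h2.2 k (by omega)
    · intro h
      refine ⟨h.1.1, ih.2 ⟨h.1.2, fun k hk => ?_⟩⟩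
      rw [← iteratedDeriv_succ']
      exact h.2 (k + 1) (by omega)

/-- The top order `2 (n + 1) - 1` of `IsRegular` reduces to `2 n + 1` by definition, whence the
closing `rfl`. -/
theorem isRegular_succ_iff {n : ℕ} {f : ℝ → ℂ} :
    IsRegular (n + 1) f ↔ ACDeriv (2 * n + 1) f := by
  rw [acDeriv_iff]; rfl

/-! ### Indefinite integrals -/

/-- The real and imaginary parts are absolutely continuous indefinite integrals, and complex
distances are at most the sum of the distances of the parts; hence the two halves of `ε`. -/
theorem IntervalIntegrable.absolutelyContinuousOnInterval_complex {u : ℝ → ℂ} {a b c : ℝ}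
    (h : IntervalIntegrable u volume a b) (hc : c ∈ uIcc a b) :
    AbsolutelyContinuousOnInterval (fun x => ∫ v in c..x, u v) a b := by
  have hre : IntervalIntegrable (fun v => (u v).re) volume a b := ⟨h.1.re, h.2.re⟩
  have him : IntervalIntegrable (fun v => (u v).im) volume a b := ⟨h.1.im, h.2.im⟩
  have h1 := hre.absolutelyContinuousOnInterval_intervalIntegral hc
  have h2 := him.absolutelyContinuousOnInterval_intervalIntegral hc
  have key : ∀ x ∈ uIcc a b, (∫ v in c..x, u v) =
      ((∫ v in c..x, (u v).re : ℝ) : ℂ) + Complex.I * ((∫ v in c..x, (u v).im : ℝ) : ℂ) := by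
    intro x hx
    have hcx : uIcc c x ⊆ uIcc a b := uIcc_subset_uIcc hc hx
    have hi : IntervalIntegrable u volume c x := h.mono_set hcx
    rw [← intervalIntegral.integral_ofReal, ← intervalIntegral.integral_ofReal,
      ← intervalIntegral.integral_const_mul, ← intervalIntegral.integral_add]
    · refine intervalIntegral.integral_congr fun v _ => ?_
      rw [mul_comm, Complex.re_add_im]
    · exact ⟨(hi.1.re).ofReal, (hi.2.re).ofReal⟩
    · exact ⟨((hi.1.im).ofReal).const_mul _, ((hi.2.im).ofReal).const_mul _⟩
  rw [absolutelyContinuousOnInterval_iff] at h1 h2 ⊢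
  intro ε hε
  obtain ⟨δ₁, hδ₁, H1⟩ := h1 (ε / 2) (by positivity)
  obtain ⟨δ₂, hδ₂, H2⟩ := h2 (ε / 2) (by positivity)
  refine ⟨min δ₁ δ₂, lt_min hδ₁ hδ₂, fun E hE hlt => ?_⟩
  have e1 := H1 E hE (hlt.trans_le (min_le_left _ _))
  have e2 := H2 E hE (hlt.trans_le (min_le_right _ _))
  have e3 := add_lt_add e1 e2
  rw [add_halves, ← Finset.sum_add_distrib] at e3
  refine lt_of_le_of_lt ?_ e3
  refine Finset.sum_le_sum fun i hi => ?_
  rw [key _ (hE.1 i hi).1, key _ (hE.1 i hi).2]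
  refine (dist_add_add_le _ _ _ _).trans (add_le_add ?_ ?_)
  · rw [dist_eq_norm, ← Complex.ofReal_sub, Complex.norm_real, ← dist_eq_norm]
  · rw [dist_eq_norm, ← mul_sub, norm_mul, Complex.norm_I, one_mul, ← Complex.ofReal_sub,
      Complex.norm_real, ← dist_eq_norm]

/-- `F` is an indefinite integral of the locally integrable function `u` on `(-1, 1)`. -/
def IsPrimitive (u F : ℝ → ℂ) : Prop :=
  ∀ a b : ℝ, -1 < a → a ≤ b → b < 1 → IntervalIntegrable u volume a b ∧
    F b - F a = ∫ v in a..b, u v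

theorem IsPrimitive.locallyAC {u F : ℝ → ℂ} (h : IsPrimitive u F) : LocallyAC F := by
  intro a b ha hab hb
  have h1 := IntervalIntegrable.absolutelyContinuousOnInterval_complex (h a b ha hab hb).1
    left_mem_uIcc
  rw [absolutelyContinuousOnInterval_iff] at h1 ⊢
  intro ε hε
  obtain ⟨δ, hδ, H⟩ := h1 ε hε
  refine ⟨δ, hδ, fun E hE hlt => ?_⟩
  refine lt_of_eq_of_lt (Finset.sum_congr rfl fun i hi => ?_) (H E hE hlt)
  have key : ∀ x ∈ uIcc a b, F x = F a + ∫ v in a..x, u v := by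
    intro x hx
    rw [uIcc_of_le hab] at hx
    rw [← (h a x ha hx.1 (hx.2.trans_lt hb)).2]
    ring
  rw [key _ (hE.1 i hi).1, key _ (hE.1 i hi).2, dist_add_left]

/-- Exhaust `(-1, 1)` by compact intervals. -/
theorem ae_Ioo_of_forall_Icc {p : ℝ → Prop}
    (H : ∀ a b : ℝ, -1 < a → a < b → b < 1 → ∀ᵐ x, x ∈ Ioo a b → p x) :
    ∀ᵐ x, x ∈ Ioo (-1 : ℝ) 1 → p x := by
  have h : ∀ k : ℕ, ∀ᵐ x : ℝ,
      x ∈ Ioo (-1 + 1 / ((k : ℝ) + 2)) (1 - 1 / ((k : ℝ) + 2)) → p x := by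
    intro k
    have h2 : (1 : ℝ) / ((k : ℝ) + 2) ≤ 1 / 2 :=
      one_div_le_one_div_of_le (by norm_num) (by linarith [(Nat.cast_nonneg k : (0 : ℝ) ≤ k)])
    have h3 : (0 : ℝ) < 1 / ((k : ℝ) + 2) := by positivity
    exact H _ _ (by linarith) (by linarith) (by linarith)
  filter_upwards [ae_all_iff.2 h] with x hx hmem
  have hpos : 0 < min (x + 1) (1 - x) := lt_min (by linarith [hmem.1]) (by linarith [hmem.2])
  obtain ⟨k, hk⟩ := exists_nat_one_div_lt hpos
  have hk' : 1 / ((k : ℝ) + 2) < min (x + 1) (1 - x) :=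
    lt_of_le_of_lt (one_div_le_one_div_of_le (by positivity) (by linarith)) hk
  exact hx k ⟨by linarith [min_le_left (x + 1) (1 - x)], by linarith [min_le_right (x + 1) (1 - x)]⟩

theorem IsPrimitive.ae_hasDerivAt {u F : ℝ → ℂ} (h : IsPrimitive u F) :
    ∀ᵐ x, x ∈ Ioo (-1 : ℝ) 1 → HasDerivAt F (u x) x := by
  refine ae_Ioo_of_forall_Icc fun a b ha hab hb => ?_
  filter_upwards [(h a b ha hab.le hb).1.ae_hasDerivAt_integral] with x hx hmem
  have h1 := hx (by rw [uIcc_of_le hab.le]; exact Ioo_subset_Icc_self hmem) a left_mem_uIcc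
  refine (h1.const_add (F a)).congr_of_eventuallyEq ?_
  filter_upwards [isOpen_Ioo.mem_nhds hmem] with y hy
  rw [← (h a y ha hy.1.le (hy.2.trans hb)).2]
  ring

theorem LocallyAC.eq_const {f : ℝ → ℂ} (hf : LocallyAC f)
    (h : ∀ᵐ x, x ∈ Ioo (-1 : ℝ) 1 → HasDerivAt f 0 x) :
    ∃ C, ∀ x ∈ Ioo (-1 : ℝ) 1, f x = C := by
  refine ⟨f 0, fun x hx => ?_⟩
  obtain ⟨a, ha, hax⟩ := exists_between (show (-1 : ℝ) < min x 0 from lt_min hx.1 (by norm_num))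
  obtain ⟨b, hxb, hb⟩ := exists_between (show max x 0 < (1 : ℝ) from max_lt hx.2 (by norm_num))
  have hab : a ≤ b := by
    have := min_le_right x 0
    have := le_max_right x 0
    linarith
  obtain ⟨C, hC⟩ := (hf a b ha hab hb).const_of_ae_hasDerivAt_zero (by
    filter_upwards [h] with y hy hmem
    rw [uIcc_of_le hab] at hmem
    exact hy ⟨by linarith [hmem.1], by linarith [hmem.2]⟩)
  rw [uIcc_of_le hab] at hC
  have := min_le_right x 0
  have := min_le_left x 0
  have := le_max_right x 0
  have := le_max_left x 0
  rw [hC x ⟨by linarith, by linarith⟩, hC 0 ⟨by linarith, by linarith⟩]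

theorem eq_const_of_hasDerivAt_zero {f : ℝ → ℂ}
    (h : ∀ x ∈ Ioo (-1 : ℝ) 1, HasDerivAt f 0 x) : ∃ C, ∀ x ∈ Ioo (-1 : ℝ) 1, f x = C := by
  refine ⟨f 0, fun x hx => ?_⟩
  exact (convex_Ioo (-1 : ℝ) 1).is_const_of_fderivWithin_eq_zero (𝕜 := ℝ)
    (fun y hy => (h y hy).differentiableAt.differentiableWithinAt)
    (fun y hy => by
      rw [fderivWithin_of_isOpen isOpen_Ioo hy]
      ext
      simpa using (h y hy).deriv) hx (by norm_num)

/-! ### The weight and the square integrable functions -/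

/-- The weight `(1 - x) ^ a (1 + x) ^ b`. -/
noncomputable def wt (a b x : ℝ) : ℝ := (1 - x) ^ a * (1 + x) ^ b

theorem wt_pos (a b : ℝ) {x : ℝ} (hx : x ∈ Ioo (-1 : ℝ) 1) : 0 < wt a b x :=
  mul_pos (Real.rpow_pos_of_pos (by linarith [hx.2]) _) (Real.rpow_pos_of_pos (by linarith [hx.1]) _)

theorem measurable_wt (a b : ℝ) : Measurable (wt a b) := by unfold wt; fun_prop

theorem contDiffOn_wt (a b : ℝ) : ContDiffOn ℝ ∞ (wt a b) (Ioo (-1 : ℝ) 1) := by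
  intro x hx
  refine ContDiffAt.contDiffWithinAt (ContDiffAt.mul ?_ ?_)
  · exact (contDiffAt_const.sub contDiffAt_id).rpow_const_of_ne (by simp; linarith [hx.2])
  · exact (contDiffAt_const.add contDiffAt_id).rpow_const_of_ne (by simp; linarith [hx.1])

theorem contDiffOn_ofReal {f : ℝ → ℝ} {s : Set ℝ} (hf : ContDiffOn ℝ ∞ f s) :
    ContDiffOn ℝ ∞ (fun x => (f x : ℂ)) s :=
  Complex.ofRealCLM.contDiff.comp_contDiffOn hf

theorem wt_le {a b : ℝ} (ha : 0 ≤ a) (hb : 0 ≤ b) {x : ℝ} (hx : x ∈ Ioo (-1 : ℝ) 1) :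
    wt a b x ≤ 2 ^ a * 2 ^ b := by
  have h1 := hx.1
  have h2 := hx.2
  exact mul_le_mul (Real.rpow_le_rpow (by linarith) (by linarith) ha)
    (Real.rpow_le_rpow (by linarith) (by linarith) hb) (Real.rpow_nonneg (by linarith) _)
    (Real.rpow_nonneg (by norm_num) _)

theorem ae_weightMeasure_iff {a b : ℝ} {p : ℝ → Prop} :
    (∀ᵐ x ∂(weightMeasure a b), p x) ↔ ∀ᵐ x, x ∈ Ioo (-1 : ℝ) 1 → p x := by
  rw [← ae_restrict_iff' measurableSet_Ioo]
  exact ⟨fun h => (ac_weightMeasure a b).ae_le h, fun h => (weightMeasure_ac a b).ae_le h⟩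

theorem ae_mem_Ioo (a b : ℝ) : ∀ᵐ x ∂(weightMeasure a b), x ∈ Ioo (-1 : ℝ) 1 :=
  ae_weightMeasure_iff.2 (Eventually.of_forall fun _ h => h)

theorem integrable_weightMeasure_iff {E : Type*} [NormedAddCommGroup E] [NormedSpace ℝ E]
    {a b : ℝ} {f : ℝ → E} : Integrable f (weightMeasure a b) ↔
      IntegrableOn (fun x => wt a b x • f x) (Ioo (-1 : ℝ) 1) := by
  rw [weightMeasure, integrable_withDensity_iff_integrable_smul' (by fun_prop) (by simp)]
  refine integrable_congr ?_
  filter_upwards [ae_restrict_mem measurableSet_Ioo] with x hx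
  change (ENNReal.ofReal (wt a b x)).toReal • f x = _
  rw [ENNReal.toReal_ofReal (wt_pos a b hx).le]

theorem setIntegral_weightMeasure {E : Type*} [NormedAddCommGroup E] [NormedSpace ℝ E]
    {a b : ℝ} (f : ℝ → E) {s : Set ℝ} (hs : MeasurableSet s) :
    ∫ x in s, f x ∂(weightMeasure a b) = ∫ x in s ∩ Ioo (-1 : ℝ) 1, wt a b x • f x := by
  rw [weightMeasure, setIntegral_withDensity_eq_setIntegral_toReal_smul (by fun_prop)
    (by simp) _ hs, Measure.restrict_restrict hs]
  refine integral_congr_ae ?_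
  filter_upwards [ae_restrict_mem (hs.inter measurableSet_Ioo)] with x hx
  change (ENNReal.ofReal (wt a b x)).toReal • f x = _
  rw [ENNReal.toReal_ofReal (wt_pos a b hx.2).le]

theorem isFiniteMeasure_weightMeasure {α β : ℝ} (hα : 0 ≤ α) (hβ : 0 ≤ β) :
    IsFiniteMeasure (weightMeasure α β) := by
  have h : Integrable (fun _ : ℝ => (1 : ℝ)) (weightMeasure α β) := by
    rw [integrable_weightMeasure_iff]
    refine Measure.integrableOn_of_bounded (M := 2 ^ α * 2 ^ β) (by simp)
      ((measurable_wt α β).smul measurable_const).aestronglyMeasurable ?_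
    filter_upwards [ae_restrict_mem measurableSet_Ioo] with x hx
    rw [smul_eq_mul, mul_one, Real.norm_of_nonneg (wt_pos α β hx).le]
    exact wt_le hα hβ hx
  rcases (integrable_const_iff.1 h) with h | h
  · exact absurd h one_ne_zero
  · exact h

theorem aestronglyMeasurable_of_continuousOn {a b : ℝ} {f : ℝ → ℂ}
    (hf : ContinuousOn f (Ioo (-1 : ℝ) 1)) : AEStronglyMeasurable f (weightMeasure a b) :=
  (hf.aestronglyMeasurable measurableSet_Ioo).mono_ac (weightMeasure_ac a b)

/-- The growth of the functions in the kernel of the powers of the Jacobi expression. -/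
noncomputable def growth (α β x : ℝ) : ℝ := 1 + (1 - x) ^ (-α) + (1 + x) ^ (-β)

theorem one_le_growth (α β : ℝ) {x : ℝ} (hx : x ∈ Ioo (-1 : ℝ) 1) : 1 ≤ growth α β x := by
  have h1 : 0 ≤ (1 - x) ^ (-α) := Real.rpow_nonneg (by linarith [hx.2]) _
  have h2 : 0 ≤ (1 + x) ^ (-β) := Real.rpow_nonneg (by linarith [hx.1]) _
  unfold growth; linarith

/-- The weight times `(1 - x) ^ (-2α)` is `(1 + x) ^ β (1 - x) ^ (-α)`, integrable because `α < 1`.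
This is where the limit circle condition enters. -/
theorem memLp_rpow_right {α β : ℝ} (hα₁ : α < 1) (hβ : 0 ≤ β) :
    MemLp (fun x : ℝ => (1 - x) ^ (-α)) 2 (weightMeasure α β) := by
  have hm : Measurable (fun x : ℝ => (1 - x) ^ (-α)) := by fun_prop
  rw [memLp_two_iff_integrable_sq hm.aestronglyMeasurable, integrable_weightMeasure_iff]
  have h1 : IntegrableOn (fun x : ℝ => (1 - x) ^ (-α)) (Ioo (-1 : ℝ) 1) := by
    have h2 : IntervalIntegrable (fun x : ℝ => x ^ (-α)) volume 2 0 :=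
      intervalIntegral.intervalIntegrable_rpow' (by linarith)
    have h3 := h2.comp_sub_left 1
    norm_num at h3
    exact (h3.1).mono_set Ioo_subset_Ioc_self
  refine Integrable.mono' (h1.const_mul (2 ^ β))
    ((measurable_wt α β).smul (hm.pow_const 2)).aestronglyMeasurable ?_
  filter_upwards [ae_restrict_mem measurableSet_Ioo] with x hx
  have p1 : 0 < 1 - x := by linarith [hx.2]
  have p2 : 0 < 1 + x := by linarith [hx.1]
  have e : wt α β x • ((1 - x) ^ (-α)) ^ 2 = (1 + x) ^ β * (1 - x) ^ (-α) := by
    rw [wt, smul_eq_mul, Real.rpow_neg p1.le]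
    have := (Real.rpow_pos_of_pos p1 α).ne'
    field_simp
  rw [e, Real.norm_of_nonneg (by positivity)]
  have : (1 + x) ^ β ≤ 2 ^ β := Real.rpow_le_rpow p2.le (by linarith [hx.2]) hβ
  gcongr

theorem memLp_rpow_left {α β : ℝ} (hα : 0 ≤ α) (hβ₁ : β < 1) :
    MemLp (fun x : ℝ => (1 + x) ^ (-β)) 2 (weightMeasure α β) := by
  have hm : Measurable (fun x : ℝ => (1 + x) ^ (-β)) := by fun_prop
  rw [memLp_two_iff_integrable_sq hm.aestronglyMeasurable, integrable_weightMeasure_iff]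
  have h1 : IntegrableOn (fun x : ℝ => (1 + x) ^ (-β)) (Ioo (-1 : ℝ) 1) := by
    have h2 : IntervalIntegrable (fun x : ℝ => x ^ (-β)) volume 0 2 :=
      intervalIntegral.intervalIntegrable_rpow' (by linarith)
    have h3 := h2.comp_add_left 1
    norm_num at h3
    exact (h3.1).mono_set Ioo_subset_Ioc_self
  refine Integrable.mono' (h1.const_mul (2 ^ α))
    ((measurable_wt α β).smul (hm.pow_const 2)).aestronglyMeasurable ?_
  filter_upwards [ae_restrict_mem measurableSet_Ioo] with x hx
  have p1 : 0 < 1 - x := by linarith [hx.2]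
  have p2 : 0 < 1 + x := by linarith [hx.1]
  have e : wt α β x • ((1 + x) ^ (-β)) ^ 2 = (1 - x) ^ α * (1 + x) ^ (-β) := by
    rw [wt, smul_eq_mul, Real.rpow_neg p2.le]
    have := (Real.rpow_pos_of_pos p2 β).ne'
    field_simp
  rw [e, Real.norm_of_nonneg (by positivity)]
  have : (1 - x) ^ α ≤ 2 ^ α := Real.rpow_le_rpow p1.le (by linarith [hx.1]) hα
  gcongr

/-- The parameters of the Jacobi expression in the limit circle case. -/
structure LimitCircle (α β : ℝ) : Prop where
  α_pos : 0 < α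
  α_lt : α < 1
  β_pos : 0 < β
  β_lt : β < 1

namespace LimitCircle

variable {α β : ℝ}

theorem finite (hp : LimitCircle α β) : IsFiniteMeasure (weightMeasure α β) :=
  isFiniteMeasure_weightMeasure hp.α_pos.le hp.β_pos.le

theorem memLp_growth (hp : LimitCircle α β) : MemLp (growth α β) 2 (weightMeasure α β) := by
  have := hp.finite
  have h1 : MemLp (fun _ : ℝ => (1 : ℝ)) 2 (weightMeasure α β) := memLp_const 1
  exact (h1.add (memLp_rpow_right hp.α_lt hp.β_pos.le)).add
    (memLp_rpow_left hp.α_pos.le hp.β_lt)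

theorem memLp_of_le_growth (hp : LimitCircle α β) {f : ℝ → ℂ}
    (hf : ContinuousOn f (Ioo (-1 : ℝ) 1)) (C : ℝ)
    (hC : ∀ x ∈ Ioo (-1 : ℝ) 1, ‖f x‖ ≤ C * growth α β x) : MemLp f 2 (weightMeasure α β) := by
  refine hp.memLp_growth.of_le_mul (aestronglyMeasurable_of_continuousOn hf) (c := C) ?_
  filter_upwards [ae_mem_Ioo α β] with x hx
  rw [Real.norm_of_nonneg (zero_le_one.trans (one_le_growth α β hx))]
  exact hC x hx

end LimitCircle

/-! ### The second solution of the homogeneous equation -/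

/-- The solution `∫ (1 - x) ^ (-α - 1) (1 + x) ^ (-β - 1)` of `ℓ[f] = 0`. -/
noncomputable def secondSol (α β x : ℝ) : ℝ := ∫ t in (0 : ℝ)..x, (wt (α + 1) (β + 1) t)⁻¹

theorem continuousOn_inv_wt (a b : ℝ) :
    ContinuousOn (fun t => (wt a b t)⁻¹) (Ioo (-1 : ℝ) 1) :=
  (contDiffOn_wt a b).continuousOn.inv₀ fun _ hx => (wt_pos a b hx).ne'

theorem uIcc_subset_Ioo {x y : ℝ} (hx : x ∈ Ioo (-1 : ℝ) 1) (hy : y ∈ Ioo (-1 : ℝ) 1) :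
    uIcc x y ⊆ Ioo (-1 : ℝ) 1 :=
  (ordConnected_Ioo.uIcc_subset hx hy)

theorem hasDerivAt_integral_of_continuousOn {E : Type*} [NormedAddCommGroup E] [NormedSpace ℝ E]
    [CompleteSpace E] {g : ℝ → E} (hg : ContinuousOn g (Ioo (-1 : ℝ) 1)) {x : ℝ}
    (hx : x ∈ Ioo (-1 : ℝ) 1) : HasDerivAt (fun y => ∫ t in (0 : ℝ)..y, g t) (g x) x := by
  have h0 : (0 : ℝ) ∈ Ioo (-1 : ℝ) 1 := by norm_num
  refine intervalIntegral.integral_hasDerivAt_right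
    (hg.mono (uIcc_subset_Ioo h0 hx)).intervalIntegrable ?_
    (hg.continuousAt (isOpen_Ioo.mem_nhds hx))
  exact hg.stronglyMeasurableAtFilter isOpen_Ioo x hx

theorem hasDerivAt_secondSol (α β : ℝ) {x : ℝ} (hx : x ∈ Ioo (-1 : ℝ) 1) :
    HasDerivAt (secondSol α β) (wt (α + 1) (β + 1) x)⁻¹ x :=
  hasDerivAt_integral_of_continuousOn (continuousOn_inv_wt _ _) hx

theorem contDiffOn_secondSol (α β : ℝ) :
    ContDiffOn ℝ ∞ (secondSol α β) (Ioo (-1 : ℝ) 1) := by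
  rw [contDiffOn_infty_iff_deriv_of_isOpen isOpen_Ioo]
  refine ⟨fun x hx => (hasDerivAt_secondSol α β hx).differentiableAt.differentiableWithinAt, ?_⟩
  refine ((contDiffOn_wt (α + 1) (β + 1)).inv fun x hx => (wt_pos _ _ hx).ne').congr fun x hx => ?_
  exact (hasDerivAt_secondSol α β hx).deriv

theorem strictMonoOn_secondSol (α β : ℝ) : StrictMonoOn (secondSol α β) (Ioo (-1 : ℝ) 1) := by
  refine strictMonoOn_of_deriv_pos (convex_Ioo _ _) (contDiffOn_secondSol α β).continuousOn ?_
  intro x hx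
  rw [interior_Ioo] at hx
  rw [(hasDerivAt_secondSol α β hx).deriv]
  exact inv_pos.2 (wt_pos _ _ hx)

theorem secondSol_zero (α β : ℝ) : secondSol α β 0 = 0 := by simp [secondSol]

/-- On `[0, 1)` the factor `(1 + y) ^ (β + 1)` is at least `1`, so the derivative of the second
solution is at most `(1 - y) ^ (-α - 1)`, the derivative of the bound. -/
theorem secondSol_le {α β : ℝ} (hα : 0 < α) (hβ : 0 < β) {x : ℝ} (hx0 : 0 ≤ x) (hx1 : x < 1) :
    secondSol α β x ≤ α⁻¹ * (1 - x) ^ (-α) := by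
  have hd : ∀ y ∈ Ico (0 : ℝ) 1, HasDerivAt (fun y => α⁻¹ * (1 - y) ^ (-α) - secondSol α β y)
      ((1 - y) ^ (-α - 1) - (wt (α + 1) (β + 1) y)⁻¹) y := by
    intro y hy
    have p1 : 0 < 1 - y := by linarith [hy.2]
    have h1 := ((((hasDerivAt_id y).const_sub 1).rpow_const (p := -α)
      (Or.inl p1.ne')).const_mul α⁻¹).sub
      (hasDerivAt_secondSol α β ⟨by linarith [hy.1], hy.2⟩)
    refine h1.congr_deriv ?_
    simp only [id]
    field_simp
  have hmono : MonotoneOn (fun y => α⁻¹ * (1 - y) ^ (-α) - secondSol α β y) (Ico (0 : ℝ) 1) := by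
    refine monotoneOn_of_deriv_nonneg (convex_Ico _ _)
      (fun y hy => (hd y hy).continuousAt.continuousWithinAt)
      (fun y hy => ((hd y (interior_subset hy)).differentiableAt).differentiableWithinAt) ?_
    intro y hy
    have hy' := interior_subset hy
    rw [(hd y hy').deriv, sub_nonneg, wt, mul_inv, show -α - 1 = -(α + 1) by ring,
      Real.rpow_neg (by linarith [hy'.2])]
    have h2 : (1 : ℝ) ≤ (1 + y) ^ (β + 1) :=
      Real.one_le_rpow (by linarith [hy'.1]) (by linarith)
    have h3 : 0 ≤ ((1 - y) ^ (α + 1))⁻¹ :=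
      inv_nonneg.2 (Real.rpow_nonneg (by linarith [hy'.2]) _)
    exact mul_le_of_le_one_right h3 (inv_le_one_of_one_le₀ h2)
  have h := hmono (show (0 : ℝ) ∈ Ico (0 : ℝ) 1 by simp) ⟨hx0, hx1⟩ hx0
  simp only [secondSol_zero, sub_zero, Real.one_rpow] at h
  have := inv_pos.2 hα
  linarith

/-- Reflection exchanges the endpoints and the parameters, so the estimate near `1` also serves near
`-1`. -/
theorem neg_secondSol_neg (α β x : ℝ) : secondSol α β x = -secondSol β α (-x) := by
  have h := intervalIntegral.integral_comp_neg (a := 0) (b := x)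
    (fun t => (wt (β + 1) (α + 1) t)⁻¹)
  rw [secondSol, secondSol, ← intervalIntegral.integral_symm, ← neg_zero, ← h, neg_zero]
  refine intervalIntegral.integral_congr fun t _ => ?_
  simp only [wt, sub_neg_eq_add, ← sub_eq_add_neg]
  rw [mul_comm]

theorem abs_secondSol_le {α β : ℝ} (hp : LimitCircle α β) {x : ℝ} (hx : x ∈ Ioo (-1 : ℝ) 1) :
    |secondSol α β x| ≤ (α⁻¹ + β⁻¹) * growth α β x := by
  have h0 : (0 : ℝ) ∈ Ioo (-1 : ℝ) 1 := by norm_num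
  have hα := inv_pos.2 hp.α_pos
  have hβ := inv_pos.2 hp.β_pos
  have p1 : 0 < (1 - x) ^ (-α) := Real.rpow_pos_of_pos (by linarith [hx.2]) _
  have p2 : 0 < (1 + x) ^ (-β) := Real.rpow_pos_of_pos (by linarith [hx.1]) _
  have m := (strictMonoOn_secondSol α β).monotoneOn
  rcases le_total 0 x with h | h
  · have h1 := m h0 hx h
    rw [secondSol_zero] at h1
    rw [abs_of_nonneg h1]
    refine (secondSol_le hp.α_pos hp.β_pos h hx.2).trans ?_
    unfold growth
    nlinarith [mul_pos hα p2, mul_pos hβ p1, mul_pos hβ p2]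
  · have h1 := m hx h0 h
    rw [secondSol_zero] at h1
    have h2 := secondSol_le hp.β_pos hp.α_pos (x := -x) (by linarith) (by linarith [hx.1])
    rw [abs_of_nonpos h1, neg_secondSol_neg, neg_neg]
    refine h2.trans ?_
    rw [sub_neg_eq_add]
    unfold growth
    nlinarith [mul_pos hα p2, mul_pos hβ p1, mul_pos hα p1]

/-! ### The Volterra right inverse of the Jacobi expression -/

/-- The difference `f - ∫ g` is locally absolutely continuous with derivative `0` almost everywhere,
hence constant. This upgrades almost-everywhere derivatives to pointwise ones. -/
theorem hasDerivAt_of_ae {f g : ℝ → ℂ} (hf : LocallyAC f)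
    (hg : ContinuousOn g (Ioo (-1 : ℝ) 1))
    (h : ∀ᵐ x, x ∈ Ioo (-1 : ℝ) 1 → HasDerivAt f (g x) x) :
    ∀ x ∈ Ioo (-1 : ℝ) 1, HasDerivAt f (g x) x := by
  have h1 : ∀ x ∈ Ioo (-1 : ℝ) 1, HasDerivAt (fun y => ∫ t in (0 : ℝ)..y, g t) (g x) x :=
    fun x hx => hasDerivAt_integral_of_continuousOn hg hx
  have h3 : LocallyAC (fun y => ∫ t in (0 : ℝ)..y, g t) := by
    apply locallyAC_of_contDiffOn
    rw [← zero_add (1 : WithTop ℕ∞), contDiffOn_succ_iff_deriv_of_isOpen isOpen_Ioo]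
    refine ⟨fun x hx => (h1 x hx).differentiableAt.differentiableWithinAt, by simp, ?_⟩
    exact contDiffOn_zero.2 (hg.congr fun x hx => (h1 x hx).deriv)
  obtain ⟨C, hC⟩ := LocallyAC.eq_const
    (f := fun y => f y - ∫ t in (0 : ℝ)..y, g t)
    (fun a b ha hab hb => (hf a b ha hab hb).sub (h3 a b ha hab hb)) (by
      filter_upwards [h] with x hx hmem
      exact ((hx hmem).fun_sub (h1 x hmem)).congr_deriv (sub_self _))
  intro x hx
  refine ((h1 x hx).const_add C).congr_of_eventuallyEq ?_
  filter_upwards [isOpen_Ioo.mem_nhds hx] with y hy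
  rw [← hC y hy]
  ring

theorem isPrimitive_setIntegral {α β : ℝ} {f : ℝ → ℂ} (hf : Integrable f (weightMeasure α β)) :
    IsPrimitive (fun x => (wt α β x : ℂ) * f x)
      (fun x => ∫ s in Iio x, f s ∂(weightMeasure α β)) := by
  intro a b ha hab hb
  have hsub : Icc a b ⊆ Ioo (-1 : ℝ) 1 := fun y hy => ⟨by linarith [hy.1], by linarith [hy.2]⟩
  constructor
  · rw [intervalIntegrable_iff_integrableOn_Icc_of_le hab]
    have h1 := integrable_weightMeasure_iff.1 hf
    refine (h1.mono_set hsub).congr (Eventually.of_forall fun x => ?_)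
    simp
  · have h1 : ∫ s in Iio b, f s ∂(weightMeasure α β) =
        ∫ s in Iio a, f s ∂(weightMeasure α β) + ∫ s in Ico a b, f s ∂(weightMeasure α β) := by
      rw [← setIntegral_union _ measurableSet_Ico hf.integrableOn hf.integrableOn,
        Iio_union_Ico_eq_Iio hab]
      exact Set.disjoint_left.2 fun x hx hx' => absurd hx'.1 (not_le.2 hx)
    simp only
    rw [h1, add_sub_cancel_left, setIntegral_weightMeasure _ measurableSet_Ico,
      inter_eq_left.2 (Ico_subset_Icc_self.trans hsub), intervalIntegral.integral_of_le hab,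
      integral_Ico_eq_integral_Ioo, integral_Ioc_eq_integral_Ioo]
    simp

/-- The solution of `ℓ[f] = h` that is small at `-1`. -/
noncomputable def volterra (α β : ℝ) (h : ℝ → ℂ) (x : ℝ) : ℂ :=
  ∫ s in Iio x, ((secondSol α β s - secondSol α β x : ℝ) : ℂ) * h s ∂(weightMeasure α β)

/-- `h` and its product with the second solution are integrable. -/
def Admissible (α β : ℝ) (h : ℝ → ℂ) : Prop :=
  Integrable h (weightMeasure α β) ∧
    Integrable (fun x => (secondSol α β x : ℂ) * h x) (weightMeasure α β)

section Admissible

variable {α β : ℝ} {h : ℝ → ℂ}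

theorem Admissible.integrable_kernel (hh : Admissible α β h) (x : ℝ) :
    Integrable (fun s => ((secondSol α β s - secondSol α β x : ℝ) : ℂ) * h s)
      (weightMeasure α β) := by
  refine (hh.2.sub (hh.1.const_mul (secondSol α β x : ℂ))).congr (Eventually.of_forall fun s => ?_)
  simp only [Pi.sub_apply, Complex.ofReal_sub]
  ring

theorem Admissible.setIntegral_kernel (hh : Admissible α β h) (x : ℝ) (s : Set ℝ) :
    ∫ t in s, ((secondSol α β t - secondSol α β x : ℝ) : ℂ) * h t ∂(weightMeasure α β) =
      ∫ t in s, (secondSol α β t : ℂ) * h t ∂(weightMeasure α β) -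
        (secondSol α β x : ℂ) * ∫ t in s, h t ∂(weightMeasure α β) := by
  rw [← integral_const_mul, ← integral_sub hh.2.integrableOn (hh.1.integrableOn.const_mul _)]
  refine integral_congr_ae (Eventually.of_forall fun t => ?_)
  simp only [Complex.ofReal_sub]
  ring

theorem hasDerivAt_secondSol_complex (α β : ℝ) {x : ℝ} (hx : x ∈ Ioo (-1 : ℝ) 1) :
    HasDerivAt (fun x => (secondSol α β x : ℂ)) ((wt (α + 1) (β + 1) x : ℂ)⁻¹) x := by
  have := (hasDerivAt_secondSol α β hx).ofReal_comp
  rwa [Complex.ofReal_inv] at this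

theorem contDiffOn_wt_complex (a b : ℝ) :
    ContDiffOn ℝ ∞ (fun x => (wt a b x : ℂ)) (Ioo (-1 : ℝ) 1) :=
  contDiffOn_ofReal (contDiffOn_wt a b)

theorem wt_ne_zero (a b : ℝ) {x : ℝ} (hx : x ∈ Ioo (-1 : ℝ) 1) : (wt a b x : ℂ) ≠ 0 :=
  Complex.ofReal_ne_zero.2 (wt_pos a b hx).ne'

theorem contDiffOn_inv_wt_complex (a b : ℝ) :
    ContDiffOn ℝ ∞ (fun x => (wt a b x : ℂ)⁻¹) (Ioo (-1 : ℝ) 1) :=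
  (contDiffOn_wt_complex a b).inv fun _ hx => wt_ne_zero a b hx

/-- In the product rule the terms containing `P h` cancel. What remains is continuous even though
`h` is not, so the formula holds at every point. -/
theorem Admissible.hasDerivAt_volterra (hh : Admissible α β h) :
    ∀ x ∈ Ioo (-1 : ℝ) 1, HasDerivAt (volterra α β h)
      (-((wt (α + 1) (β + 1) x : ℂ)⁻¹ * ∫ s in Iio x, h s ∂(weightMeasure α β))) x := by
  have hP := contDiffOn_ofReal (contDiffOn_secondSol α β)
  have hF := isPrimitive_setIntegral hh.2
  have hG := isPrimitive_setIntegral hh.1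
  have e : volterra α β h = fun x =>
      (∫ t in Iio x, (secondSol α β t : ℂ) * h t ∂(weightMeasure α β)) +
        (-(secondSol α β x : ℂ)) * ∫ t in Iio x, h t ∂(weightMeasure α β) := by
    funext x
    rw [volterra, hh.setIntegral_kernel]
    ring
  refine hasDerivAt_of_ae ?_ ?_ ?_
  · rw [e]
    exact ACDeriv.add (m := 0) hF.locallyAC (ACDeriv.mul (m := 0) hP.neg hG.locallyAC)
  · exact ((contDiffOn_inv_wt_complex _ _).continuousOn.mul hG.locallyAC.continuousOn).neg
  · filter_upwards [hF.ae_hasDerivAt, hG.ae_hasDerivAt] with x h1 h2 hx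
    rw [e]
    refine ((h1 hx).add ((hasDerivAt_secondSol_complex α β hx).neg.mul (h2 hx))).congr_deriv ?_
    simp only [Pi.neg_apply]
    ring

end Admissible

/-! ### The Jacobi expression in terms of the flux `-(1 - x) ^ (α + 1) (1 + x) ^ (β + 1) f'` -/

/-- With the flux as second unknown, the second-order expression becomes two first-order relations,
and regularity is gained in two single steps. -/
theorem jacobi_eq_of_flux {α β : ℝ} {f Γ : ℝ → ℂ}
    (h : ∀ x ∈ Ioo (-1 : ℝ) 1, HasDerivAt f (-((wt (α + 1) (β + 1) x : ℂ)⁻¹ * Γ x)) x) {x : ℝ}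
    (hx : x ∈ Ioo (-1 : ℝ) 1) : jacobi α β f x = (wt α β x : ℂ)⁻¹ * deriv Γ x := by
  have h1 : (fun y => (((1 - y) ^ (α + 1) * (1 + y) ^ (β + 1) : ℝ) : ℂ) * deriv f y) =ᶠ[𝓝 x]
      fun y => -Γ y := by
    filter_upwards [isOpen_Ioo.mem_nhds hx] with y hy
    rw [(h y hy).deriv]
    change (wt (α + 1) (β + 1) y : ℂ) * _ = _
    have := wt_ne_zero (α + 1) (β + 1) hy
    field_simp
  rw [jacobi, h1.deriv_eq, deriv.fun_neg]
  change -((wt α β x : ℂ)⁻¹ * _) = _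
  ring

theorem acDeriv_of_flux {α β : ℝ} {m : ℕ} {f Γ : ℝ → ℂ}
    (h : ∀ x ∈ Ioo (-1 : ℝ) 1, HasDerivAt f (-((wt (α + 1) (β + 1) x : ℂ)⁻¹ * Γ x)) x)
    (hΓ : ACDeriv m Γ) : ACDeriv (m + 1) f := by
  refine ⟨fun x hx => (h x hx).differentiableAt.differentiableWithinAt, ?_⟩
  refine (ACDeriv.mul (contDiffOn_inv_wt_complex (α + 1) (β + 1)).neg hΓ).congr fun x hx => ?_
  rw [(h x hx).deriv]
  simp only [neg_mul]

theorem ACDeriv.exists_flux (α β : ℝ) {m : ℕ} {f : ℝ → ℂ} (hf : ACDeriv (m + 1) f) :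
    ∃ Γ : ℝ → ℂ, ACDeriv m Γ ∧
      ∀ x ∈ Ioo (-1 : ℝ) 1, HasDerivAt f (-((wt (α + 1) (β + 1) x : ℂ)⁻¹ * Γ x)) x := by
  refine ⟨fun x => -(wt (α + 1) (β + 1) x : ℂ) * deriv f x,
    ACDeriv.mul (contDiffOn_wt_complex _ _).neg hf.2, fun x hx => ?_⟩
  refine (differentiableAt_of_Ioo hf.1 hx).hasDerivAt.congr_deriv ?_
  have := wt_ne_zero (α + 1) (β + 1) hx
  field_simp

theorem ACDeriv.jacobi {α β : ℝ} {m : ℕ} {f : ℝ → ℂ} (hf : ACDeriv (m + 2) f) :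
    ACDeriv m (jacobi α β f) := by
  obtain ⟨Γ, hΓ, h⟩ := hf.exists_flux α β
  exact (ACDeriv.mul (contDiffOn_inv_wt_complex α β) hΓ.2).congr fun x hx =>
    (jacobi_eq_of_flux h hx).symm

/-! ### The operator and the kernel in the weighted space -/

namespace LimitCircle

variable {α β : ℝ}

theorem memLp_secondSol (hp : LimitCircle α β) :
    MemLp (fun x => (secondSol α β x : ℂ)) 2 (weightMeasure α β) := by
  refine hp.memLp_of_le_growth (contDiffOn_ofReal (contDiffOn_secondSol α β)).continuousOn
    (α⁻¹ + β⁻¹) fun x hx => ?_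
  rw [Complex.norm_real]
  exact abs_secondSol_le hp hx

theorem admissible (hp : LimitCircle α β) {h : ℝ → ℂ} (hh : MemLp h 2 (weightMeasure α β)) :
    Admissible α β h := by
  have := hp.finite
  exact ⟨hh.integrable one_le_two, hp.memLp_secondSol.integrable_mul hh⟩

theorem continuousOn_volterra (hp : LimitCircle α β) {h : ℝ → ℂ}
    (hh : MemLp h 2 (weightMeasure α β)) : ContinuousOn (volterra α β h) (Ioo (-1 : ℝ) 1) :=
  fun x hx => ((hp.admissible hh).hasDerivAt_volterra x hx).continuousAt.continuousWithinAt

/-- Splitting the kernel bounds `V h` by `‖P h‖₁ + |P(x)| ‖h‖₁`, hence by a multiple of `growth`,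
which is square integrable. -/
theorem memLp_volterra (hp : LimitCircle α β) {h : ℝ → ℂ} (hh : MemLp h 2 (weightMeasure α β)) :
    MemLp (volterra α β h) 2 (weightMeasure α β) := by
  have hA := hp.admissible hh
  set A := ∫ t, ‖(secondSol α β t : ℂ) * h t‖ ∂(weightMeasure α β)
  set B := ∫ t, ‖h t‖ ∂(weightMeasure α β)
  have hA0 : 0 ≤ A := integral_nonneg fun _ => norm_nonneg _
  have hB0 : 0 ≤ B := integral_nonneg fun _ => norm_nonneg _
  refine hp.memLp_of_le_growth (hp.continuousOn_volterra hh) (A + (α⁻¹ + β⁻¹) * B) fun x hx => ?_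
  rw [volterra, hA.setIntegral_kernel]
  have h1 : ‖∫ t in Iio x, (secondSol α β t : ℂ) * h t ∂(weightMeasure α β)‖ ≤ A :=
    (norm_integral_le_integral_norm _).trans
      (setIntegral_le_integral hA.2.norm (Eventually.of_forall fun _ => norm_nonneg _))
  have h2 : ‖∫ t in Iio x, h t ∂(weightMeasure α β)‖ ≤ B :=
    (norm_integral_le_integral_norm _).trans
      (setIntegral_le_integral hA.1.norm (Eventually.of_forall fun _ => norm_nonneg _))
  have h3 := abs_secondSol_le hp hx
  have h4 := one_le_growth α β hx
  refine (norm_sub_le _ _).trans ?_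
  rw [norm_mul, Complex.norm_real, Real.norm_eq_abs]
  have h5 : |secondSol α β x| * ‖∫ t in Iio x, h t ∂(weightMeasure α β)‖ ≤
      ((α⁻¹ + β⁻¹) * growth α β x) * B :=
    mul_le_mul h3 h2 (norm_nonneg _) ((abs_nonneg _).trans h3)
  nlinarith

theorem volterra_congr {h g : ℝ → ℂ} (hg : h =ᵐ[weightMeasure α β] g) :
    volterra α β h = volterra α β g := by
  funext x
  refine integral_congr_ae (ae_restrict_of_ae ?_)
  filter_upwards [hg] with s hs
  rw [hs]

/-- The Volterra right inverse of the Jacobi expression as an operator on the weighted space. -/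
noncomputable def volterraOp (hp : LimitCircle α β) : L2 α β →ₗ[ℂ] L2 α β where
  toFun h := (hp.memLp_volterra (Lp.memLp h)).toLp _
  map_add' h g := by
    rw [← MemLp.toLp_add]
    congr 1
    funext x
    rw [volterra_congr (Lp.coeFn_add h g), Pi.add_apply, volterra, volterra, volterra,
      ← integral_add ((hp.admissible (Lp.memLp h)).integrable_kernel x).integrableOn
        ((hp.admissible (Lp.memLp g)).integrable_kernel x).integrableOn]
    refine integral_congr_ae (Eventually.of_forall fun s => ?_)
    simp only [Pi.add_apply]
    ring
  map_smul' c h := by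
    rw [RingHom.id_apply, ← MemLp.toLp_const_smul]
    congr 1
    funext x
    rw [volterra_congr (Lp.coeFn_smul c h), Pi.smul_apply, volterra, volterra, smul_eq_mul,
      ← integral_const_mul]
    refine integral_congr_ae (Eventually.of_forall fun s => ?_)
    simp only [Pi.smul_apply, smul_eq_mul]
    ring

theorem coeFn_volterraOp (hp : LimitCircle α β) (h : L2 α β) :
    hp.volterraOp h =ᵐ[weightMeasure α β] volterra α β h :=
  MemLp.coeFn_toLp (hp.memLp_volterra (Lp.memLp h))

/-- The class of the constant function `1`. -/
noncomputable def oneL2 (hp : LimitCircle α β) : L2 α β :=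
  (hp.memLp_of_le_growth (f := fun _ => 1) continuousOn_const 1 (fun x hx => by
    rw [one_mul, norm_one]; exact one_le_growth α β hx)).toLp _

/-- The class of the second solution of the homogeneous equation. -/
noncomputable def secondL2 (hp : LimitCircle α β) : L2 α β := hp.memLp_secondSol.toLp _

theorem coeFn_oneL2 (hp : LimitCircle α β) :
    hp.oneL2 =ᵐ[weightMeasure α β] fun _ => (1 : ℂ) := MemLp.coeFn_toLp _

theorem coeFn_secondL2 (hp : LimitCircle α β) :
    hp.secondL2 =ᵐ[weightMeasure α β] fun x => (secondSol α β x : ℂ) := MemLp.coeFn_toLp _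

/-- The kernel of the maximal operator of `ℓ`. -/
noncomputable def kernel (hp : LimitCircle α β) : Submodule ℂ (L2 α β) :=
  Submodule.span ℂ {hp.oneL2, hp.secondL2}

theorem coeFn_combination (hp : LimitCircle α β) (c d : ℂ) :
    (c • hp.oneL2 + d • hp.secondL2 : L2 α β) =ᵐ[weightMeasure α β]
      fun x => c + d * (secondSol α β x : ℂ) := by
  filter_upwards [Lp.coeFn_add (c • hp.oneL2) (d • hp.secondL2), Lp.coeFn_smul c hp.oneL2,
    Lp.coeFn_smul d hp.secondL2, hp.coeFn_oneL2, hp.coeFn_secondL2] with x h1 h2 h3 h4 h5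
  rw [h1, Pi.add_apply, h2, h3, Pi.smul_apply, Pi.smul_apply, h4, h5, smul_eq_mul, smul_eq_mul,
    mul_one]

theorem mem_kernel_iff (hp : LimitCircle α β) (k : L2 α β) : k ∈ hp.kernel ↔
    ∃ c d : ℂ, k =ᵐ[weightMeasure α β] fun x => c + d * (secondSol α β x : ℂ) := by
  rw [kernel, Submodule.mem_span_pair]
  constructor
  · rintro ⟨c, d, rfl⟩
    exact ⟨c, d, hp.coeFn_combination c d⟩
  · rintro ⟨c, d, h⟩
    exact ⟨c, d, Lp.ext ((hp.coeFn_combination c d).trans h.symm)⟩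

theorem eqOn_of_ae_eq {f g : ℝ → ℂ} (hf : ContinuousOn f (Ioo (-1 : ℝ) 1))
    (hg : ContinuousOn g (Ioo (-1 : ℝ) 1)) (h : f =ᵐ[weightMeasure α β] g) :
    EqOn f g (Ioo (-1 : ℝ) 1) :=
  Measure.eqOn_open_of_ae_eq ((ac_weightMeasure α β).ae_le h) isOpen_Ioo hf hg

instance (hp : LimitCircle α β) : FiniteDimensional ℂ hp.kernel :=
  FiniteDimensional.span_of_finite ℂ (by simp)

theorem finrank_kernel (hp : LimitCircle α β) : Module.finrank ℂ hp.kernel = 2 := by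
  have hli : LinearIndependent ℂ ![hp.oneL2, hp.secondL2] := by
    rw [LinearIndependent.pair_iff]
    intro c d h
    have h1 : (fun x => c + d * (secondSol α β x : ℂ)) =ᵐ[weightMeasure α β] fun _ => 0 := by
      refine (hp.coeFn_combination c d).symm.trans ?_
      rw [h]
      exact Lp.coeFn_zero _ _ _
    have hP := (contDiffOn_ofReal (contDiffOn_secondSol α β)).continuousOn
    have h2 : EqOn (fun x => c + d * (secondSol α β x : ℂ)) (fun _ => 0) (Ioo (-1 : ℝ) 1) :=
      eqOn_of_ae_eq (continuousOn_const.add (continuousOn_const.mul hP))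
        continuousOn_const h1
    -- Two sample points separate the solutions: `P(0) = 0` and `P(1/2) > 0`.
    have hc := h2 (show (0 : ℝ) ∈ Ioo (-1 : ℝ) 1 by norm_num)
    have hd := h2 (show (1 / 2 : ℝ) ∈ Ioo (-1 : ℝ) 1 by norm_num)
    simp only [secondSol_zero, Complex.ofReal_zero, mul_zero, add_zero] at hc
    subst hc
    have hpos := strictMonoOn_secondSol α β (show (0 : ℝ) ∈ Ioo (-1 : ℝ) 1 by norm_num)
      (show (1 / 2 : ℝ) ∈ Ioo (-1 : ℝ) 1 by norm_num) (by norm_num)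
    rw [secondSol_zero] at hpos
    simp only [zero_add, mul_eq_zero, Complex.ofReal_eq_zero, hpos.ne', or_false] at hd
    exact ⟨rfl, hd⟩
  have h2 := finrank_span_eq_card hli
  have h3 : range ![hp.oneL2, hp.secondL2] = {hp.oneL2, hp.secondL2} := by
    ext x
    simp [or_comm]
  rw [h3] at h2
  exact h2

/-! ### The graph of the maximal operator -/

/-- The last clause permits iteration: `ℓⁿ` differentiates `ℓ[f]` again, so an almost-everywhere
identity `ℓ[f] = g` is not enough. A regular representative `g` of `h` makes it hold everywhere and
raises the regularity by two. -/
theorem exists_solution (hp : LimitCircle α β) (h k : L2 α β) (hk : k ∈ hp.kernel) :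
    ∃ f : ℝ → ℂ, (hp.volterraOp h + k : L2 α β) =ᵐ[weightMeasure α β] f ∧ ACDeriv 1 f ∧
      h =ᵐ[weightMeasure α β] jacobi α β f ∧
      ∀ (m : ℕ) (g : ℝ → ℂ), ACDeriv m g → h =ᵐ[weightMeasure α β] g →
        ACDeriv (m + 2) f ∧ EqOn (jacobi α β f) g (Ioo (-1 : ℝ) 1) := by
  obtain ⟨c, d, hcd⟩ := (hp.mem_kernel_iff k).1 hk
  have hA := hp.admissible (Lp.memLp h)
  have hG := isPrimitive_setIntegral hA.1
  set G : ℝ → ℂ := fun x => ∫ s in Iio x, h s ∂(weightMeasure α β) with hGdef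
  -- The flux of `V h` is `G`, and that of `c + d P` is the constant `-d`.
  have hf : ∀ x ∈ Ioo (-1 : ℝ) 1,
      HasDerivAt (fun x => volterra α β h x + (c + d * (secondSol α β x : ℂ)))
      (-((wt (α + 1) (β + 1) x : ℂ)⁻¹ * (G x + -d))) x := by
    intro x hx
    refine ((hA.hasDerivAt_volterra x hx).add
      (((hasDerivAt_secondSol_complex α β hx).const_mul d).const_add c)).congr_deriv ?_
    simp only [hGdef]
    ring
  have hconst : ∀ m, ACDeriv m (fun _ => -d) := fun m => acDeriv_of_contDiffOn m contDiffOn_const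
  have hder : ∀ᵐ x ∂(weightMeasure α β), HasDerivAt G ((wt α β x : ℂ) * h x) x :=
    ae_weightMeasure_iff.2 hG.ae_hasDerivAt
  have hder' : ∀ x, deriv (fun y => G y + -d) x = deriv G x := fun x => deriv_add_const _
  refine ⟨_, ?_, acDeriv_of_flux hf (ACDeriv.add (m := 0) hG.locallyAC (hconst 0)), ?_, ?_⟩
  · filter_upwards [Lp.coeFn_add (hp.volterraOp h) k, hp.coeFn_volterraOp h, hcd] with x h1 h2 h3
    rw [h1, Pi.add_apply, h2, h3]
  · filter_upwards [hder, ae_mem_Ioo α β] with x h1 hx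
    rw [jacobi_eq_of_flux hf hx, hder', h1.deriv, inv_mul_cancel_left₀ (wt_ne_zero α β hx)]
  · intro m g hg hhg
    have hd : ∀ x ∈ Ioo (-1 : ℝ) 1, HasDerivAt G ((wt α β x : ℂ) * g x) x := by
      refine hasDerivAt_of_ae hG.locallyAC
        ((contDiffOn_wt_complex α β).continuousOn.mul hg.continuousOn) ?_
      rw [← ae_weightMeasure_iff (a := α) (b := β)]
      filter_upwards [hder, hhg] with x h1 h2
      rwa [← h2]
    have hG' : ACDeriv (m + 1) G :=
      ⟨fun x hx => (hd x hx).differentiableAt.differentiableWithinAt,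
        (hg.mul (contDiffOn_wt_complex α β)).congr fun x hx => (hd x hx).deriv.symm⟩
    refine ⟨acDeriv_of_flux hf (hG'.add (hconst _)), fun x hx => ?_⟩
    rw [jacobi_eq_of_flux hf hx, hder', (hd x hx).deriv,
      inv_mul_cancel_left₀ (wt_ne_zero α β hx)]

/-- Two integrations: the fluxes of `f` and of `V h` have the same derivative almost everywhere, so
they differ by a constant `d`; then `f - V h + d P` has derivative `0`. -/
theorem eq_volterraOp_add (hp : LimitCircle α β) {f : ℝ → ℂ} (hf : ACDeriv 1 f) (h : L2 α β)
    (hh : h =ᵐ[weightMeasure α β] jacobi α β f) :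
    ∃ k ∈ hp.kernel, (hp.volterraOp h + k : L2 α β) =ᵐ[weightMeasure α β] f := by
  obtain ⟨Γ, hΓ, hfΓ⟩ := hf.exists_flux α β
  have hA := hp.admissible (Lp.memLp h)
  have hG := isPrimitive_setIntegral hA.1
  obtain ⟨d, hd⟩ := LocallyAC.eq_const
    (f := fun x => Γ x - ∫ s in Iio x, h s ∂(weightMeasure α β))
    (fun a b ha hab hb => (hΓ a b ha hab hb).sub (hG.locallyAC a b ha hab hb)) (by
      rw [← ae_weightMeasure_iff (a := α) (b := β)]
      filter_upwards [hh, ae_weightMeasure_iff.2 hG.ae_hasDerivAt, ae_mem_Ioo α β,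
        (weightMeasure_ac α β).ae_le (LocallyAC.ae_differentiableAt hΓ)] with x h1 h2 hx h3
      have h4 := h3.hasDerivAt.sub h2
      rw [h1, jacobi_eq_of_flux hfΓ hx, mul_inv_cancel_left₀ (wt_ne_zero α β hx), sub_self] at h4
      exact h4)
  obtain ⟨c, hc⟩ := eq_const_of_hasDerivAt_zero
    (f := fun x => f x - volterra α β h x + d * (secondSol α β x : ℂ)) (fun x hx => by
      refine (((hfΓ x hx).sub (hA.hasDerivAt_volterra x hx)).add
        ((hasDerivAt_secondSol_complex α β hx).const_mul d)).congr_deriv ?_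
      rw [← hd x hx]
      ring)
  refine ⟨c • hp.oneL2 + (-d) • hp.secondL2,
    (hp.mem_kernel_iff _).2 ⟨c, -d, hp.coeFn_combination c (-d)⟩, ?_⟩
  filter_upwards [Lp.coeFn_add (hp.volterraOp h) (c • hp.oneL2 + (-d) • hp.secondL2),
    hp.coeFn_volterraOp h, hp.coeFn_combination c (-d), ae_mem_Ioo α β] with x h1 h2 h3 hx
  rw [h1, Pi.add_apply, h2, h3, ← hc x hx]
  ring

theorem eq_volterraOp_pow_add (hp : LimitCircle α β) (m : ℕ) {f : ℝ → ℂ}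
    (hf : ACDeriv (2 * m + 1) f) (h : L2 α β)
    (hh : h =ᵐ[weightMeasure α β] jacobiPow α β (m + 1) f) :
    ∃ k ∈ kerPow hp.volterraOp hp.kernel (m + 1),
      ((hp.volterraOp ^ (m + 1)) h + k : L2 α β) =ᵐ[weightMeasure α β] f := by
  induction m generalizing f with
  | zero => simpa [kerPow] using hp.eq_volterraOp_add hf h hh
  | succ m ih =>
    obtain ⟨k, hk, hk'⟩ := ih (f := jacobi α β f) (ACDeriv.jacobi hf) hh
    obtain ⟨k', hk₁, hk₁'⟩ := hp.eq_volterraOp_add (hf.of_le (by omega)) _ hk'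
    refine ⟨k' + hp.volterraOp k, Submodule.add_mem_sup hk₁ (Submodule.mem_map_of_mem hk), ?_⟩
    rw [map_add, ← Module.End.mul_apply, ← pow_succ'] at hk₁'
    rw [add_comm k', ← add_assoc]
    exact hk₁'

theorem exists_solution_pow (hp : LimitCircle α β) (m : ℕ) (h : L2 α β) {k : L2 α β}
    (hk : k ∈ kerPow hp.volterraOp hp.kernel (m + 1)) :
    ∃ f : ℝ → ℂ, ACDeriv (2 * m + 1) f ∧
      ((hp.volterraOp ^ (m + 1)) h + k : L2 α β) =ᵐ[weightMeasure α β] f ∧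
      h =ᵐ[weightMeasure α β] jacobiPow α β (m + 1) f := by
  induction m generalizing k with
  | zero =>
    rw [zero_add, kerPow_one] at hk
    obtain ⟨f, h1, h2, h3, -⟩ := hp.exists_solution h k hk
    exact ⟨f, h2, by simpa using h1, h3⟩
  | succ m ih =>
    obtain ⟨k₀, hk₀, y, hy, rfl⟩ := Submodule.mem_sup.1 hk
    obtain ⟨k₁, hk₁, rfl⟩ := Submodule.mem_map.1 hy
    obtain ⟨g, hg, hg', hg''⟩ := ih hk₁
    obtain ⟨f, h1, -, -, h4⟩ := hp.exists_solution ((hp.volterraOp ^ (m + 1)) h + k₁) k₀ hk₀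
    obtain ⟨h5, h6⟩ := h4 _ g hg hg'
    refine ⟨f, h5, ?_, ?_⟩
    · rw [map_add, ← Module.End.mul_apply, ← pow_succ'] at h1
      rw [add_comm k₀, ← add_assoc]
      exact h1
    · filter_upwards [hg'', ae_mem_Ioo α β] with x h7 hx
      rw [h7]
      refine ((jacobiPow_congr α β (m + 1) ?_).self_of_nhds).symm
      filter_upwards [isOpen_Ioo.mem_nhds hx] with y hy using h6 hy

theorem mem_maxGraph_iff (hp : LimitCircle α β) {n : ℕ} (hn : 1 ≤ n) (f h : L2 α β) :
    (f, h) ∈ maxGraph α β n ↔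
      f - (hp.volterraOp ^ n) h ∈ kerPow hp.volterraOp hp.kernel n := by
  obtain ⟨m, rfl⟩ := Nat.exists_eq_add_of_le' hn
  constructor
  · rintro ⟨g, hg, h1, h2⟩
    obtain ⟨k, hk, hk'⟩ := hp.eq_volterraOp_pow_add m (isRegular_succ_iff.1 hg) h h2
    have : f = (hp.volterraOp ^ (m + 1)) h + k := Lp.ext (h1.trans hk'.symm)
    rwa [this, add_sub_cancel_left]
  · intro hk
    obtain ⟨g, h1, h2, h3⟩ := hp.exists_solution_pow m h hk
    rw [add_sub_cancel] at h2
    exact ⟨g, isRegular_succ_iff.2 h1, h2, h3⟩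

/-! ### Symmetry of the right inverse on the orthogonal complement of the kernel -/

theorem inner_eq {u v : L2 α β} {f g : ℝ → ℂ} (hu : u =ᵐ[weightMeasure α β] f)
    (hv : v =ᵐ[weightMeasure α β] g) :
    ⟪u, v⟫_ℂ = ∫ x, (starRingEnd ℂ) (f x) * g x ∂(weightMeasure α β) := by
  rw [L2.inner_def]
  refine integral_congr_ae ?_
  filter_upwards [hu, hv] with x h1 h2
  rw [h1, h2, RCLike.inner_apply, mul_comm]

theorem integral_eq_zero_of_mem_orthogonal (hp : LimitCircle α β) {h : L2 α β}
    (hh : h ∈ hp.kernelᗮ) : ∫ x, h x ∂(weightMeasure α β) = 0 ∧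
      ∫ x, (secondSol α β x : ℂ) * h x ∂(weightMeasure α β) = 0 := by
  have h1 := (Submodule.mem_orthogonal _ _).1 hh hp.oneL2 (Submodule.subset_span (by simp))
  have h2 := (Submodule.mem_orthogonal _ _).1 hh hp.secondL2 (Submodule.subset_span (by simp))
  rw [inner_eq hp.coeFn_oneL2 (ae_eq_refl h)] at h1
  rw [inner_eq hp.coeFn_secondL2 (ae_eq_refl h)] at h2
  simp only [map_one, one_mul, Complex.conj_ofReal] at h1 h2
  exact ⟨h1, h2⟩

/-- For `h` orthogonal to `1` and to the real function `P`, the kernel integrated against `h` over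
the whole interval vanishes, so the two one-sided integrals are opposite. -/
theorem volterra_eq_neg (hp : LimitCircle α β) {h : L2 α β} (hh : h ∈ hp.kernelᗮ) (x : ℝ) :
    volterra α β h x = -∫ s in Ioi x, ((secondSol α β s - secondSol α β x : ℝ) : ℂ) * h s
      ∂(weightMeasure α β) := by
  have hA := hp.admissible (Lp.memLp h)
  obtain ⟨h1, h2⟩ := hp.integral_eq_zero_of_mem_orthogonal hh
  have h3 := integral_add_compl (measurableSet_Iio (a := x)) (hA.integrable_kernel x)
  rw [compl_Iio, ← setIntegral_univ (μ := weightMeasure α β), hA.setIntegral_kernel x univ,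
    setIntegral_univ, setIntegral_univ, h1, h2, mul_zero, sub_zero] at h3
  have h4 : ∫ s in Ici x, ((secondSol α β s - secondSol α β x : ℝ) : ℂ) * h s
      ∂(weightMeasure α β) = ∫ s in Ioi x, ((secondSol α β s - secondSol α β x : ℝ) : ℂ) * h s
      ∂(weightMeasure α β) := by
    exact integral_Ici_eq_integral_Ioi' (weightMeasure_ac α β (by simp))
  rw [← h4]
  exact eq_neg_of_add_eq_zero_left h3

/-- Both sides are iterated integrals of `conj (h s) (P x - P s) u x` over `x < s`: on the left `V
h` is written as an integral over `s > x`, on the right `V u` is one over `x < s`. -/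
theorem symm_volterraOp (hp : LimitCircle α β) {h : L2 α β} (hh : h ∈ hp.kernelᗮ) (u : L2 α β) :
    ⟪hp.volterraOp h, u⟫_ℂ = ⟪h, hp.volterraOp u⟫_ℂ := by
  have := hp.finite
  have hAh := hp.admissible (Lp.memLp h)
  have hAu := hp.admissible (Lp.memLp u)
  rw [inner_eq (hp.coeFn_volterraOp h) (ae_eq_refl u),
    inner_eq (ae_eq_refl h) (hp.coeFn_volterraOp u)]
  let Φ : ℝ → ℝ → ℂ := fun x s => (Ioi x).indicator (fun s =>
    -((starRingEnd ℂ) (((secondSol α β s - secondSol α β x : ℝ) : ℂ) * h s)) * u x) s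
  have e1 : ∀ x, (starRingEnd ℂ) (volterra α β h x) * u x =
      ∫ s, Φ x s ∂(weightMeasure α β) := by
    intro x
    rw [hp.volterra_eq_neg hh, integral_indicator measurableSet_Ioi, integral_mul_const,
      integral_neg, integral_conj, map_neg]
  have e2 : ∀ s, (starRingEnd ℂ) (h s) * volterra α β u s =
      ∫ x, Φ x s ∂(weightMeasure α β) := by
    intro s
    have : (fun x => Φ x s) = (Iio s).indicator (fun x =>
        (starRingEnd ℂ) (h s) * (((secondSol α β x - secondSol α β s : ℝ) : ℂ) * u x)) := by
      funext x
      by_cases hxs : x < s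
      · rw [indicator_of_mem (show x ∈ Iio s from hxs)]
        simp only [Φ]
        rw [indicator_of_mem (show s ∈ Ioi x from hxs)]
        simp only [map_mul, map_sub, Complex.conj_ofReal, Complex.ofReal_sub]
        ring
      · rw [indicator_of_notMem (show x ∉ Iio s from hxs)]
        simp only [Φ]
        rw [indicator_of_notMem (show s ∉ Ioi x from hxs)]
    rw [this, integral_indicator measurableSet_Iio, integral_const_mul, volterra]
  simp only [e1, e2]
  refine integral_integral_swap ?_
  have hconj : ∀ {g : ℝ → ℂ}, Integrable g (weightMeasure α β) →
      Integrable (fun s => (starRingEnd ℂ) (g s)) (weightMeasure α β) := fun hg =>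
    (Complex.conjLIE.toContinuousLinearEquiv.toContinuousLinearMap.integrable_comp hg)
  -- The kernel `P x - P s` splits the integrand into two products of integrable functions of one
  -- variable.
  have i1 := hAu.2.mul_prod (hconj hAh.1)
  have i2 := hAu.1.mul_prod (hconj hAh.2)
  have hS : MeasurableSet {p : ℝ × ℝ | p.1 < p.2} := measurableSet_lt measurable_fst measurable_snd
  refine ((i1.sub i2).indicator hS).congr (Eventually.of_forall fun p => ?_)
  obtain ⟨x, s⟩ := p
  simp only [Function.uncurry, Φ]
  by_cases hxs : x < s
  · rw [indicator_of_mem (show (x, s) ∈ {p : ℝ × ℝ | p.1 < p.2} from hxs),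
      indicator_of_mem (show s ∈ Ioi x from hxs)]
    simp only [Pi.sub_apply, map_mul, map_sub, Complex.conj_ofReal, Complex.ofReal_sub]
    ring
  · rw [indicator_of_notMem (show (x, s) ∉ {p : ℝ × ℝ | p.1 < p.2} from hxs),
      indicator_of_notMem (show s ∉ Ioi x from hxs)]

theorem symmetricRightInverse (hp : LimitCircle α β) :
    SymmetricRightInverse hp.volterraOp hp.kernel where
  symm _ hh u := hp.symm_volterraOp hh u
  inj h hh := by
    -- If `V h ∈ K`, both `(V h, h)` and `(V h, 0)` lie in the single-valued maximal graph.
    have h1 : (hp.volterraOp h, h) ∈ maxGraph α β 1 :=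
      (hp.mem_maxGraph_iff le_rfl _ _).2 (by simp)
    have h2 : (hp.volterraOp h, 0) ∈ maxGraph α β 1 :=
      (hp.mem_maxGraph_iff le_rfl _ _).2 (by simpa [kerPow_one] using hh)
    have h3 := maxGraph_single_valued α β _ (Submodule.sub_mem _ h1 h2) (by simp)
    simpa using h3

theorem graph_maxOp (α β : ℝ) (n : ℕ) : (maxOp α β n).graph = maxGraph α β n :=
  Submodule.toLinearPMap_graph_eq _ fun p hp h0 => maxGraph_single_valued α β p hp h0

theorem isMaxMinPair (hp : LimitCircle α β) {n : ℕ} (hn : 1 ≤ n) :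
    IsMaxMinPair hp.volterraOp hp.kernel n (maxOp α β n) (minDomain α β n) where
  mem_graph f h := by rw [graph_maxOp, hp.mem_maxGraph_iff hn]
  mem_min u := by
    constructor
    · rintro ⟨hu, h⟩
      refine ⟨maxOp α β n ⟨u, hu⟩, LinearPMap.mem_graph _ ⟨u, hu⟩, fun g w hg => ?_⟩
      have hg' := LinearPMap.mem_domain_of_mem_graph hg
      have h1 := h ⟨g, hg'⟩
      rw [greenForm, sub_eq_zero, ← (LinearPMap.image_iff hg').2 hg] at h1
      exact h1
    · rintro ⟨v, hv, h⟩
      have hu := LinearPMap.mem_domain_of_mem_graph hv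
      refine ⟨hu, fun g => ?_⟩
      rw [greenForm, sub_eq_zero, ← (LinearPMap.image_iff hu).2 hv]
      exact h _ _ (LinearPMap.mem_graph _ g)

end LimitCircle

/-! ### Endpoint expansions -/

section Expansion

open Polynomial

/-- `f` is `A (1 + x) + (1 + x) ^ (-β) B (1 + x)` near `-1`. -/
def Expansion (β : ℝ) (A B : ℂ[X]) (f : ℝ → ℂ) : Prop :=
  ∀ᶠ x in 𝓝[>] (-1 : ℝ), f x = A.eval ((1 + x : ℝ) : ℂ) +
    (((1 + x) ^ (-β) : ℝ) : ℂ) * B.eval ((1 + x : ℝ) : ℂ)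

/-- The action of the Jacobi expression on `(1 + x) ^ e A (1 + x)` when `e (e + β) = 0`. -/
noncomputable def jacobiPoly (α β e : ℝ) (A : ℂ[X]) : ℂ[X] :=
  C ((α + 1 : ℝ) : ℂ) * (X * derivative A + C (e : ℂ) * A) -
    (C 2 - X) * (C ((β + e : ℝ) : ℂ) * derivative A +
      derivative (X * derivative A + C (e : ℂ) * A))

/-- When `e (e + β) = 0`, the factor `(j + 1) (j + 1 + β + 2 e)` is the indicial polynomial `s (s +
β)` at `s = e + j + 1`. It governs how `ℓ` lowers the exponent by one. -/
theorem coeff_jacobiPoly (α β e : ℝ) (A : ℂ[X]) (j : ℕ) :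
    (jacobiPoly α β e A).coeff j = ((α + 1) * (j + e) + j * (β + e + j + e)) * A.coeff j -
      2 * (j + 1) * (j + 1 + β + 2 * e) * A.coeff (j + 1) := by
  have hB : ∀ i, (X * derivative A + C (e : ℂ) * A).coeff i = (i + e) * A.coeff i := by
    intro i
    rcases i with _ | i
    · simp
    · rw [coeff_add, coeff_X_mul, coeff_C_mul, coeff_derivative]
      push_cast
      ring
  have hW : ∀ i, (C ((β + e : ℝ) : ℂ) * derivative A +
      derivative (X * derivative A + C (e : ℂ) * A)).coeff i =
      (i + 1) * (i + 1 + β + 2 * e) * A.coeff (i + 1) := by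
    intro i
    rw [coeff_add, coeff_C_mul, coeff_derivative, coeff_derivative, hB]
    push_cast
    ring
  rw [jacobiPoly, coeff_sub, coeff_C_mul, hB, sub_mul, coeff_sub, coeff_C_mul, hW]
  rcases j with _ | j
  · rw [coeff_X_mul_zero]
    push_cast
    ring
  · rw [coeff_X_mul, hW]
    push_cast
    ring

/-- The recursion for `A.coeff (j + 1)` has a nonzero factor, so `n` vanishing coefficients of the
image and the initial one give `n + 1`. -/
theorem coeff_eq_zero_of_jacobiPoly {α β e : ℝ} (he : 0 < 1 + β + 2 * e) {A : ℂ[X]} {n : ℕ}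
    (h0 : A.coeff 0 = 0) (h : ∀ j < n, (jacobiPoly α β e A).coeff j = 0) :
    ∀ j < n + 1, A.coeff j = 0 := by
  intro j
  induction j with
  | zero => exact fun _ => h0
  | succ j ih =>
    intro hj
    have h1 := h j (by omega)
    rw [coeff_jacobiPoly, ih (by omega), mul_zero, zero_sub, neg_eq_zero, mul_eq_zero] at h1
    refine h1.resolve_left ?_
    have h2 : (0 : ℝ) < 2 * (j + 1) * (j + 1 + β + 2 * e) := by
      have : (0 : ℝ) ≤ j := Nat.cast_nonneg j
      have h3 : (0 : ℝ) < j + 1 + β + 2 * e := by linarith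
      positivity
    exact_mod_cast h2.ne'

theorem hasDerivAt_eval_one_add (A : ℂ[X]) (x : ℝ) :
    HasDerivAt (fun y : ℝ => A.eval ((1 + y : ℝ) : ℂ))
      ((derivative A).eval ((1 + x : ℝ) : ℂ)) x := by
  have h1 : HasDerivAt (fun y : ℝ => ((1 + y : ℝ) : ℂ)) 1 x := by
    simpa using ((hasDerivAt_id x).const_add 1).ofReal_comp
  have h2 := (A.hasDerivAt ((1 + x : ℝ) : ℂ)).comp x h1
  rw [mul_one] at h2
  exact h2

theorem hasDerivAt_rpow_one_add (e : ℝ) {x : ℝ} (hx : -1 < x) :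
    HasDerivAt (fun y : ℝ => (((1 + y) ^ e : ℝ) : ℂ)) ((e * (1 + x) ^ (e - 1) : ℝ) : ℂ) x := by
  have h := (((hasDerivAt_id x).const_add 1).rpow_const (p := e)
    (Or.inl (by simp only [id]; linarith))).ofReal_comp
  simpa using h

theorem hasDerivAt_rpow_one_sub (e : ℝ) {x : ℝ} (hx : x < 1) :
    HasDerivAt (fun y : ℝ => (((1 - y) ^ e : ℝ) : ℂ)) ((-e * (1 - x) ^ (e - 1) : ℝ) : ℂ) x := by
  have h := (((hasDerivAt_id x).const_sub 1).rpow_const (p := e)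
    (Or.inl (by simp only [id]; linarith))).ofReal_comp
  simpa using h

/-- The flux of `(1 + x) ^ e A (1 + x)`. -/
noncomputable def powFlux (α β e : ℝ) (A : ℂ[X]) (x : ℝ) : ℂ :=
  -((((1 - x) ^ (α + 1) : ℝ) : ℂ) * ((((1 + x) ^ (β + e) : ℝ) : ℂ) *
    (X * derivative A + C (e : ℂ) * A).eval ((1 + x : ℝ) : ℂ)))

theorem hasDerivAt_pow_mul_eval (α β e : ℝ) (A : ℂ[X]) {x : ℝ} (hx : x ∈ Ioo (-1 : ℝ) 1) :
    HasDerivAt (fun y : ℝ => (((1 + y) ^ e : ℝ) : ℂ) * A.eval ((1 + y : ℝ) : ℂ))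
      (-((wt (α + 1) (β + 1) x : ℂ)⁻¹ * powFlux α β e A x)) x := by
  refine ((hasDerivAt_rpow_one_add e hx.1).mul (hasDerivAt_eval_one_add A x)).congr_deriv ?_
  have p1 : 0 < 1 - x := by linarith [hx.2]
  have p2 : 0 < 1 + x := by linarith [hx.1]
  have n1 : (((1 - x) ^ (α + 1) : ℝ) : ℂ) ≠ 0 :=
    Complex.ofReal_ne_zero.2 (Real.rpow_pos_of_pos p1 _).ne'
  have n2 : (((1 + x) ^ β : ℝ) : ℂ) ≠ 0 :=
    Complex.ofReal_ne_zero.2 (Real.rpow_pos_of_pos p2 _).ne'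
  have n3 : ((1 + x : ℝ) : ℂ) ≠ 0 := Complex.ofReal_ne_zero.2 p2.ne'
  simp only [wt, powFlux, eval_add, eval_mul, eval_X, eval_C, Complex.ofReal_mul,
    Real.rpow_add p2, Real.rpow_sub p2, Real.rpow_one, Complex.ofReal_div]
  field_simp
  ring

/-- Differentiating `(1 + x) ^ (β + e)` leaves a pole `e (e + β) A / (1 + x)`; the indicial equation
removes it and only a polynomial factor remains. -/
theorem hasDerivAt_powFlux {α β e : ℝ} (he : e * (e + β) = 0) (A : ℂ[X]) {x : ℝ}
    (hx : x ∈ Ioo (-1 : ℝ) 1) :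
    HasDerivAt (powFlux α β e A) ((wt α β x : ℂ) *
      ((((1 + x) ^ e : ℝ) : ℂ) * (jacobiPoly α β e A).eval ((1 + x : ℝ) : ℂ))) x := by
  refine ((hasDerivAt_rpow_one_sub (α + 1) hx.2).fun_mul ((hasDerivAt_rpow_one_add (β + e) hx.1).fun_mul
    (hasDerivAt_eval_one_add (X * derivative A + C (e : ℂ) * A) x))).fun_neg.congr_deriv ?_
  have p1 : 0 < 1 - x := by linarith [hx.2]
  have p2 : 0 < 1 + x := by linarith [hx.1]
  have n3 : ((1 + x : ℝ) : ℂ) ≠ 0 := Complex.ofReal_ne_zero.2 p2.ne'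
  have e1 : ((1 - x : ℝ) : ℂ) = 2 - ((1 + x : ℝ) : ℂ) := by push_cast; ring
  have he' : (e : ℂ) * (e + β) = 0 := by exact_mod_cast he
  rw [show α + 1 - 1 = α by ring]
  simp only [wt, jacobiPoly, eval_add, eval_sub, eval_mul, eval_X, eval_C, Complex.ofReal_mul,
    Real.rpow_add p2, Real.rpow_add p1, Real.rpow_sub p2, Real.rpow_one, Complex.ofReal_div, e1,
    Complex.ofReal_neg, Complex.ofReal_add α, Complex.ofReal_add β, Complex.ofReal_one]
  generalize ((1 + x : ℝ) : ℂ) = t at *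
  generalize eval t (derivative (X * derivative A + C (e : ℂ) * A)) = D
  generalize (((1 - x) ^ α : ℝ) : ℂ) = u
  generalize (((1 + x) ^ β : ℝ) : ℂ) = v
  generalize (((1 + x) ^ e : ℝ) : ℂ) = w
  field_simp
  linear_combination (-(2 - t) * eval t A * u * v * w) * he'

/-- Provides full neighbourhoods of nearby points, so that an expansion valid near the endpoint may
be differentiated. -/
theorem eventually_nhdsGT_nhds {p : ℝ → Prop} (h : ∀ᶠ x in 𝓝[>] (-1 : ℝ), p x) :
    ∀ᶠ x in 𝓝[>] (-1 : ℝ), x ∈ Ioo (-1 : ℝ) 1 ∧ ∀ᶠ y in 𝓝 x, p y := by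
  obtain ⟨u, hu, hsub⟩ := (mem_nhdsGT_iff_exists_Ioo_subset).1 h
  filter_upwards [Ioo_mem_nhdsGT (show (-1 : ℝ) < min u 1 from lt_min hu (by norm_num))] with x hx
  have hx2 := lt_min_iff.1 hx.2
  refine ⟨⟨hx.1, hx2.2⟩, ?_⟩
  filter_upwards [Ioo_mem_nhds hx.1 hx2.1] with y hy using hsub hy

theorem Expansion.jacobi {α β : ℝ} {A B : ℂ[X]} {f : ℝ → ℂ} (h : Expansion β A B f) :
    Expansion β (jacobiPoly α β 0 A) (jacobiPoly α β (-β) B) (jacobi α β f) := by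
  filter_upwards [eventually_nhdsGT_nhds h] with x hx
  have h1 : ∀ x ∈ Ioo (-1 : ℝ) 1, HasDerivAt (fun y : ℝ => A.eval ((1 + y : ℝ) : ℂ) +
      (((1 + y) ^ (-β) : ℝ) : ℂ) * B.eval ((1 + y : ℝ) : ℂ))
      (-((wt (α + 1) (β + 1) x : ℂ)⁻¹ * (powFlux α β 0 A x + powFlux α β (-β) B x))) x := by
    intro x hx
    have h2 := hasDerivAt_pow_mul_eval α β 0 A hx
    simp only [Real.rpow_zero, Complex.ofReal_one, one_mul] at h2
    refine (h2.add (hasDerivAt_pow_mul_eval α β (-β) B hx)).congr_deriv ?_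
    ring
  rw [(jacobi_congr α β hx.2).self_of_nhds, jacobi_eq_of_flux h1 hx.1,
    ((hasDerivAt_powFlux (by ring) A hx.1).fun_add (hasDerivAt_powFlux (by ring) B hx.1)).deriv]
  have := wt_ne_zero α β hx.1
  rw [Real.rpow_zero, Complex.ofReal_one, one_mul]
  field_simp

theorem Expansion.add {β : ℝ} {A B A' B' : ℂ[X]} {f g : ℝ → ℂ} (hf : Expansion β A B f)
    (hg : Expansion β A' B' g) : Expansion β (A + A') (B + B') (f + g) := by
  filter_upwards [hf, hg] with x h1 h2
  rw [Pi.add_apply, h1, h2, eval_add, eval_add]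
  ring

theorem Expansion.smul {β : ℝ} {A B : ℂ[X]} {f : ℝ → ℂ} (c : ℂ) (hf : Expansion β A B f) :
    Expansion β (c • A) (c • B) (c • f) := by
  filter_upwards [hf] with x h1
  rw [Pi.smul_apply, h1, eval_smul, eval_smul]
  simp only [smul_eq_mul]
  ring

theorem Expansion.zero (β : ℝ) : Expansion β 0 0 0 :=
  Eventually.of_forall fun x => by simp

theorem exists_bound_eval (A : ℂ[X]) :
    ∃ M : ℝ, 0 ≤ M ∧ ∀ x ∈ Ioo (-1 : ℝ) 1, ‖A.eval ((1 + x : ℝ) : ℂ)‖ ≤ M := by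
  have hc : Continuous fun x : ℝ => A.eval ((1 + x : ℝ) : ℂ) :=
    A.continuous.comp (Complex.continuous_ofReal.comp (continuous_const.add continuous_id))
  obtain ⟨M, hM⟩ := (isCompact_Icc (a := (-1 : ℝ)) (b := 1)).exists_bound_of_continuousOn
    hc.continuousOn
  exact ⟨M, (norm_nonneg _).trans (hM 0 (by norm_num)), fun x hx => hM x (Ioo_subset_Icc_self hx)⟩

theorem Expansion.exists_bound (α : ℝ) {β : ℝ} {A B : ℂ[X]} {f : ℝ → ℂ}
    (h : Expansion β A B f) :
    ∃ M : ℝ, 0 ≤ M ∧ ∀ᶠ x in 𝓝[>] (-1 : ℝ), ‖f x‖ ≤ M * growth α β x := by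
  obtain ⟨M₁, h1, hM₁⟩ := exists_bound_eval A
  obtain ⟨M₂, h2, hM₂⟩ := exists_bound_eval B
  refine ⟨M₁ + M₂, add_nonneg h1 h2, ?_⟩
  filter_upwards [h, Ioo_mem_nhdsGT (show (-1 : ℝ) < 1 by norm_num)] with x hx hmem
  have q1 : 0 ≤ (1 - x) ^ (-α) := Real.rpow_nonneg (by linarith [hmem.2]) _
  have q2 : 0 ≤ (1 + x) ^ (-β) := Real.rpow_nonneg (by linarith [hmem.1]) _
  rw [hx]
  refine (norm_add_le _ _).trans ?_
  rw [norm_mul, Complex.norm_real, Real.norm_of_nonneg q2]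
  have h3 := mul_le_mul_of_nonneg_left (hM₂ x hmem) q2
  have h4 := hM₁ x hmem
  unfold growth
  nlinarith [mul_nonneg h1 q1, mul_nonneg h1 q2, mul_nonneg h2 q1]

/-- Multiplying by `(1 + x) ^ β → 0` isolates `B(0)`. Once it vanishes, the singular part is `(1 +
x) ^ (1 - β)` times a polynomial and tends to `0`, which leaves `A(0)`. -/
theorem Expansion.coeff_zero {β : ℝ} (hβ₀ : 0 < β) (hβ₁ : β < 1) {A B : ℂ[X]} {f : ℝ → ℂ}
    (h : Expansion β A B f) (hf : Tendsto f (𝓝[>] (-1 : ℝ)) (𝓝 0)) :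
    A.coeff 0 = 0 ∧ B.coeff 0 = 0 := by
  have ht : Tendsto (fun x : ℝ => 1 + x) (𝓝[>] (-1 : ℝ)) (𝓝 0) := by
    have : ContinuousAt (fun x : ℝ => 1 + x) (-1) := by fun_prop
    simpa using this.tendsto.mono_left nhdsWithin_le_nhds
  have hpos : ∀ᶠ x in 𝓝[>] (-1 : ℝ), 0 < 1 + x := by
    filter_upwards [self_mem_nhdsWithin] with x hx
    have : -1 < x := hx
    linarith
  have hpoly : ∀ D : ℂ[X], Tendsto (fun x : ℝ => D.eval ((1 + x : ℝ) : ℂ)) (𝓝[>] (-1 : ℝ))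
      (𝓝 (D.coeff 0)) := by
    intro D
    have h1 : Tendsto (fun z : ℝ => D.eval (z : ℂ)) (𝓝 0) (𝓝 (D.eval ((0 : ℝ) : ℂ))) :=
      (D.continuous.comp Complex.continuous_ofReal).tendsto 0
    rw [Complex.ofReal_zero, ← coeff_zero_eq_eval_zero] at h1
    exact h1.comp ht
  have hrpow : ∀ {e : ℝ}, 0 < e → Tendsto (fun x : ℝ => (((1 + x) ^ e : ℝ) : ℂ))
      (𝓝[>] (-1 : ℝ)) (𝓝 0) := by
    intro e he
    have h1 := ht.rpow_const (p := e) (Or.inr he.le)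
    rw [Real.zero_rpow he.ne'] at h1
    have h2 := (Complex.continuous_ofReal.tendsto 0).comp h1
    rwa [Complex.ofReal_zero] at h2
  have hB : B.coeff 0 = 0 := by
    have h1 := ((hrpow hβ₀).mul hf).sub ((hrpow hβ₀).mul (hpoly A))
    simp only [zero_mul, sub_zero] at h1
    refine tendsto_nhds_unique (hpoly B) (h1.congr' ?_)
    filter_upwards [h, hpos] with x hx hx0
    have h2 : (((1 + x) ^ β : ℝ) : ℂ) * (((1 + x) ^ (-β) : ℝ) : ℂ) = 1 := by
      rw [← Complex.ofReal_mul, ← Real.rpow_add hx0, add_neg_cancel, Real.rpow_zero,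
        Complex.ofReal_one]
    rw [hx]
    linear_combination (eval ((1 + x : ℝ) : ℂ) B) * h2
  refine ⟨?_, hB⟩
  have hB' : B = X * B.divX := by
    conv_lhs => rw [← X_mul_divX_add B, hB, C_0, add_zero]
  have h1 := hf.sub ((hrpow (sub_pos.2 hβ₁)).mul (hpoly B.divX))
  simp only [zero_mul, sub_zero] at h1
  refine tendsto_nhds_unique (hpoly A) (h1.congr' ?_)
  filter_upwards [h, hpos] with x hx hx0
  have h2 : (((1 + x) ^ (1 - β) : ℝ) : ℂ) = ((1 + x : ℝ) : ℂ) * (((1 + x) ^ (-β) : ℝ) : ℂ) := by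
    rw [← Complex.ofReal_mul, sub_eq_add_neg, Real.rpow_add hx0, Real.rpow_one]
  have h3 : B.eval ((1 + x : ℝ) : ℂ) = ((1 + x : ℝ) : ℂ) * B.divX.eval ((1 + x : ℝ) : ℂ) := by
    conv_lhs => rw [hB', eval_mul, eval_X]
  rw [hx, h2, h3]
  ring

/-! ### Reflection and expansions at both endpoints -/

theorem jacobi_comp_neg (α β : ℝ) (f : ℝ → ℂ) (x : ℝ) :
    jacobi α β f (-x) = jacobi β α (fun y => f (-y)) x := by
  set q : ℝ → ℂ := fun z => (((1 - z) ^ (α + 1) * (1 + z) ^ (β + 1) : ℝ) : ℂ) * deriv f z with hq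
  have h1 : (fun y => (((1 - y) ^ (β + 1) * (1 + y) ^ (α + 1) : ℝ) : ℂ) *
      deriv (fun z => f (-z)) y) = fun y => -q (-y) := by
    funext y
    simp only [hq, deriv_comp_neg, sub_neg_eq_add, ← sub_eq_add_neg]
    push_cast
    ring
  rw [jacobi, ← hq, jacobi, h1, deriv.fun_neg, deriv_comp_neg q]
  simp only [sub_neg_eq_add, ← sub_eq_add_neg, neg_neg]
  push_cast
  ring

/-- `f` is smooth on `(-1, 1)` with the expansions `A`, `B` at `-1` and `A'`, `B'` at `1`. -/
structure HasExpansions (α β : ℝ) (A B A' B' : ℂ[X]) (f : ℝ → ℂ) : Prop where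
  smooth : ContDiffOn ℝ ∞ f (Ioo (-1 : ℝ) 1)
  left : Expansion β A B f
  right : Expansion α A' B' fun x => f (-x)

namespace HasExpansions

variable {α β : ℝ} {A B A' B' : ℂ[X]} {f : ℝ → ℂ}

theorem jacobi (h : HasExpansions α β A B A' B' f) :
    HasExpansions α β (jacobiPoly α β 0 A) (jacobiPoly α β (-β) B) (jacobiPoly β α 0 A')
      (jacobiPoly β α (-α) B') (jacobi α β f) where
  smooth := ((contDiffOn_inv_wt_complex α β).mul
    (contDiffOn_deriv ((contDiffOn_wt_complex (α + 1) (β + 1)).mul (contDiffOn_deriv h.smooth)))).neg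
  left := h.left.jacobi
  right := by
    have := h.right.jacobi (α := β)
    exact this.mono fun x hx => (jacobi_comp_neg α β f x).trans hx

theorem sum {ι : Type*} (s : Finset ι) (c : ι → ℂ) {P Q P' Q' : ι → ℂ[X]} {F : ι → ℝ → ℂ}
    (h : ∀ i, HasExpansions α β (P i) (Q i) (P' i) (Q' i) (F i)) :
    HasExpansions α β (∑ i ∈ s, c i • P i) (∑ i ∈ s, c i • Q i) (∑ i ∈ s, c i • P' i)
      (∑ i ∈ s, c i • Q' i) (∑ i ∈ s, c i • F i) := by
  classical
  induction s using Finset.induction_on with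
  | empty => exact ⟨contDiffOn_const, Expansion.zero β, Expansion.zero α⟩
  | insert i s hi ih =>
    simp only [Finset.sum_insert hi]
    exact ⟨(contDiffOn_const.smul (h i).smooth).add ih.smooth,
      ((h i).left.smul (c i)).add ih.left, ((h i).right.smul (c i)).add ih.right⟩

theorem memLp (hp : LimitCircle α β) (h : HasExpansions α β A B A' B' f) :
    MemLp f 2 (weightMeasure α β) := by
  obtain ⟨M₁, h1, hM₁⟩ := h.left.exists_bound α
  obtain ⟨M₂, h2, hM₂⟩ := h.right.exists_bound β
  obtain ⟨u, hu, hu'⟩ := (mem_nhdsGT_iff_exists_Ioo_subset).1 hM₁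
  obtain ⟨v, hv, hv'⟩ := (mem_nhdsGT_iff_exists_Ioo_subset).1 hM₂
  have hu1 : -1 < u := hu
  have hv1 : -1 < v := hv
  -- The comparisons with `0` keep the compact interval inside `(-1, 1)`, as `u` and `v` have no
  -- upper bound.
  obtain ⟨M₃, hM₃⟩ := (isCompact_Icc (a := min u 0) (b := max (-v) 0)).exists_bound_of_continuousOn
    (h.smooth.continuousOn.mono fun x hx => ⟨(lt_min hu1 (by norm_num)).trans_le hx.1,
      hx.2.trans_lt (max_lt (by linarith) (by norm_num))⟩)
  refine hp.memLp_of_le_growth h.smooth.continuousOn (M₁ + M₂ + max M₃ 0) fun x hx => ?_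
  have hg := one_le_growth α β hx
  have h3 : 0 ≤ max M₃ 0 := le_max_right _ _
  by_cases hxu : x < u
  · have h4 : ‖f x‖ ≤ M₁ * growth α β x := hu' ⟨hx.1, hxu⟩
    nlinarith
  by_cases hxv : -v < x
  · have h4 : ‖f (- -x)‖ ≤ M₂ * growth β α (-x) := hv' ⟨by linarith [hx.2], by linarith⟩
    have h5 : growth β α (-x) = growth α β x := by
      simp only [growth, sub_neg_eq_add, ← sub_eq_add_neg]
      ring
    rw [neg_neg, h5] at h4
    nlinarith
  · have h4 := hM₃ x ⟨(min_le_left _ _).trans (not_lt.1 hxu),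
      (not_lt.1 hxv).trans (le_max_left _ _)⟩
    have h5 := le_max_left M₃ 0
    nlinarith

/-- Expansions are stable under `ℓ` and imply square integrability, so every power of `ℓ` keeps `f`
in `L²`. -/
theorem mem_maxGraph (hp : LimitCircle α β) (h : HasExpansions α β A B A' B' f) (n : ℕ)
    {u : L2 α β} (hu : u =ᵐ[weightMeasure α β] f) : ∃ w, (u, w) ∈ maxGraph α β n ∧
      w =ᵐ[weightMeasure α β] jacobiPow α β n f := by
  have h1 : ∀ (n : ℕ) {f : ℝ → ℂ} {A B A' B' : ℂ[X]}, HasExpansions α β A B A' B' f →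
      MemLp (jacobiPow α β n f) 2 (weightMeasure α β) := by
    intro n
    induction n with
    | zero => exact fun h => h.memLp hp
    | succ n ih => exact fun h => ih h.jacobi
  have h2 := acDeriv_iff.1 (acDeriv_of_contDiffOn (2 * n) h.smooth)
  refine ⟨(h1 n h).toLp _, ⟨f, ⟨h2.1.of_le (by exact_mod_cast Nat.sub_le _ _),
    fun k hk => h2.2 k (by omega)⟩, hu, (h1 n h).coeFn_toLp⟩, (h1 n h).coeFn_toLp⟩

end HasExpansions

end Expansion

/-! ### The minimal domain has no leading terms at the endpoints -/

namespace LimitCircle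

variable {α β : ℝ}

/-- Dominated convergence, although `P` is unbounded: for `s < x < 0` monotonicity gives `P(s) ≤
P(x) ≤ 0`, so `|P(s) - P(x)| ≤ |P(s)|`, uniformly in `x`. -/
theorem tendsto_volterra_left (hp : LimitCircle α β) (h : L2 α β) :
    Tendsto (volterra α β h) (𝓝[>] (-1 : ℝ)) (𝓝 0) := by
  have hA := hp.admissible (Lp.memLp h)
  have h0 : (0 : ℝ) ∈ Ioo (-1 : ℝ) 1 := by norm_num
  have m := (strictMonoOn_secondSol α β).monotoneOn
  have key : Tendsto (fun x => ∫ s, (Iio x).indicator (fun s =>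
      ((secondSol α β s - secondSol α β x : ℝ) : ℂ) * h s) s ∂(weightMeasure α β))
      (𝓝[>] (-1 : ℝ)) (𝓝 (∫ _, (0 : ℂ) ∂(weightMeasure α β))) := by
    refine tendsto_integral_filter_of_dominated_convergence
      (fun s => ‖(secondSol α β s : ℂ) * h s‖) ?_ ?_ hA.2.norm ?_
    · exact Eventually.of_forall fun x =>
        (hA.integrable_kernel x).aestronglyMeasurable.indicator measurableSet_Iio
    · filter_upwards [Ioo_mem_nhdsGT (show (-1 : ℝ) < 0 by norm_num)] with x hx
      filter_upwards [ae_mem_Ioo α β] with s hs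
      by_cases hsx : s < x
      · rw [indicator_of_mem (show s ∈ Iio x from hsx), norm_mul, norm_mul, Complex.norm_real,
          Complex.norm_real, Real.norm_eq_abs, Real.norm_eq_abs]
        have hx' : x ∈ Ioo (-1 : ℝ) 1 := ⟨hx.1, hx.2.trans one_pos⟩
        have h1 := m hs hx' hsx.le
        have h2 := m hx' h0 hx.2.le
        rw [secondSol_zero] at h2
        refine mul_le_mul_of_nonneg_right ?_ (norm_nonneg _)
        rw [abs_of_nonpos (by linarith), abs_of_nonpos (by linarith)]
        linarith
      · rw [indicator_of_notMem (show s ∉ Iio x from hsx), norm_zero]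
        exact norm_nonneg _
    · filter_upwards [ae_mem_Ioo α β] with s hs
      refine tendsto_const_nhds.congr' ?_
      filter_upwards [Ioo_mem_nhdsGT hs.1] with x hx
      rw [indicator_of_notMem (show s ∉ Iio x from not_lt.2 hx.2.le)]
  rw [integral_zero] at key
  refine key.congr fun x => ?_
  rw [integral_indicator measurableSet_Iio, volterra]

/-- Orthogonality to the kernel rewrites `V h` as an integral over `(x, 1)`, to which the domination
argument at the left endpoint applies in mirror image. -/
theorem tendsto_volterra_right (hp : LimitCircle α β) {h : L2 α β} (hh : h ∈ hp.kernelᗮ) :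
    Tendsto (volterra α β h) (𝓝[<] (1 : ℝ)) (𝓝 0) := by
  have hA := hp.admissible (Lp.memLp h)
  have h0 : (0 : ℝ) ∈ Ioo (-1 : ℝ) 1 := by norm_num
  have m := (strictMonoOn_secondSol α β).monotoneOn
  have key : Tendsto (fun x => ∫ s, (Ioi x).indicator (fun s =>
      ((secondSol α β s - secondSol α β x : ℝ) : ℂ) * h s) s ∂(weightMeasure α β))
      (𝓝[<] (1 : ℝ)) (𝓝 (∫ _, (0 : ℂ) ∂(weightMeasure α β))) := by
    refine tendsto_integral_filter_of_dominated_convergence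
      (fun s => ‖(secondSol α β s : ℂ) * h s‖) ?_ ?_ hA.2.norm ?_
    · exact Eventually.of_forall fun x =>
        (hA.integrable_kernel x).aestronglyMeasurable.indicator measurableSet_Ioi
    · filter_upwards [Ioo_mem_nhdsLT (show (0 : ℝ) < 1 by norm_num)] with x hx
      filter_upwards [ae_mem_Ioo α β] with s hs
      by_cases hsx : x < s
      · rw [indicator_of_mem (show s ∈ Ioi x from hsx), norm_mul, norm_mul, Complex.norm_real,
          Complex.norm_real, Real.norm_eq_abs, Real.norm_eq_abs]
        have hx' : x ∈ Ioo (-1 : ℝ) 1 := ⟨by linarith [hx.1], hx.2⟩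
        have h1 := m hx' hs hsx.le
        have h2 := m h0 hx' hx.1.le
        rw [secondSol_zero] at h2
        refine mul_le_mul_of_nonneg_right ?_ (norm_nonneg _)
        rw [abs_of_nonneg (by linarith), abs_of_nonneg (by linarith)]
        linarith
      · rw [indicator_of_notMem (show s ∉ Ioi x from hsx), norm_zero]
        exact norm_nonneg _
    · filter_upwards [ae_mem_Ioo α β] with s hs
      refine tendsto_const_nhds.congr' ?_
      filter_upwards [Ioo_mem_nhdsLT hs.2] with x hx
      rw [indicator_of_notMem (show s ∉ Ioi x from not_lt.2 hx.1.le)]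
  rw [integral_zero] at key
  have key' := key.neg
  rw [neg_zero] at key'
  refine key'.congr fun x => ?_
  rw [integral_indicator measurableSet_Ioi, hp.volterra_eq_neg hh]

open Polynomial in
-- Induction through `f = V g` with `g = Vⁿ h`: the limits of `V g` kill the coefficients of order
-- `0`, and the induction hypothesis for `ℓ[f] = g` kills the others through the coefficient
-- recursion.
theorem coeff_eq_zero (hp : LimitCircle α β) (n : ℕ) {A B A' B' : ℂ[X]} {f : ℝ → ℂ}
    (hf : HasExpansions α β A B A' B' f) {h : L2 α β}
    (hh : h ∈ (kerPow hp.volterraOp hp.kernel n)ᗮ)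
    (hfh : (hp.volterraOp ^ n) h =ᵐ[weightMeasure α β] f) :
    ∀ j < n, (A.coeff j = 0 ∧ B.coeff j = 0) ∧ A'.coeff j = 0 ∧ B'.coeff j = 0 := by
  induction n generalizing A B A' B' f with
  | zero => exact fun j hj => absurd hj (Nat.not_lt_zero j)
  | succ n ih =>
    have hV := hp.symmetricRightInverse
    set g := (hp.volterraOp ^ n) h with hg
    have hgK : g ∈ hp.kernelᗮ := by
      have := hV.pow_mem_orthogonal n 1 hh
      rwa [kerPow_one] at this
    rw [pow_succ', Module.End.mul_apply, ← hg] at hfh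
    have hfg : EqOn (volterra α β g) f (Ioo (-1 : ℝ) 1) :=
      eqOn_of_ae_eq (hp.continuousOn_volterra (Lp.memLp g)) hf.smooth.continuousOn
        ((hp.coeFn_volterraOp g).symm.trans hfh)
    have hl : Tendsto f (𝓝[>] (-1 : ℝ)) (𝓝 0) := by
      refine (hp.tendsto_volterra_left g).congr' ?_
      filter_upwards [Ioo_mem_nhdsGT (show (-1 : ℝ) < 1 by norm_num)] with x hx using hfg hx
    have hr : Tendsto (fun x => f (-x)) (𝓝[>] (-1 : ℝ)) (𝓝 0) := by
      have h1 : Tendsto f (𝓝[<] (1 : ℝ)) (𝓝 0) := by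
        refine (hp.tendsto_volterra_right hgK).congr' ?_
        filter_upwards [Ioo_mem_nhdsLT (show (-1 : ℝ) < 1 by norm_num)] with x hx using hfg hx
      have h2 := tendsto_neg_nhdsGT (a := (-1 : ℝ))
      rw [neg_neg] at h2
      exact h1.comp h2
    obtain ⟨a0, b0⟩ := hf.left.coeff_zero hp.β_pos hp.β_lt hl
    obtain ⟨a0', b0'⟩ := hf.right.coeff_zero hp.α_pos hp.α_lt hr
    obtain ⟨w, hw, hw'⟩ := hf.mem_maxGraph hp 1 hfh
    have hVg : (hp.volterraOp g, g) ∈ maxGraph α β 1 :=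
      (hp.mem_maxGraph_iff le_rfl _ _).2 (by simp)
    -- Both `(f, ℓ[f])` and `(V g, g)` lie in the single-valued maximal graph with the same first
    -- component.
    have hwg : w = g := by
      have := maxGraph_single_valued α β _ (Submodule.sub_mem _ hw hVg) (by simp)
      simpa [sub_eq_zero] using this
    rw [hwg] at hw'
    have h3 := ih hf.jacobi (Submodule.orthogonal_le
      (by rw [kerPow_add]; exact le_sup_left) hh) hw'
    have hα₀ := hp.α_pos
    have hβ₀ := hp.β_pos
    have hα₁ := hp.α_lt
    have hβ₁ := hp.β_lt
    intro j hj
    -- The positivity conditions are `1 + β > 0` for `e = 0` and `1 - β > 0` for `e = -β`, and the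
    -- same with `α` at the other endpoint.
    exact ⟨⟨coeff_eq_zero_of_jacobiPoly (by linarith) a0 (fun j hj => (h3 j hj).1.1) j hj,
      coeff_eq_zero_of_jacobiPoly (by linarith) b0 (fun j hj => (h3 j hj).1.2) j hj⟩,
      coeff_eq_zero_of_jacobiPoly (by linarith) a0' (fun j hj => (h3 j hj).2.1) j hj,
      coeff_eq_zero_of_jacobiPoly (by linarith) b0' (fun j hj => (h3 j hj).2.2) j hj⟩

end LimitCircle

/-! ### The endpoint functions -/

section EndpointFunctions

open Polynomial

variable {α β : ℝ} {j : ℕ} {f : ℝ → ℂ}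

theorem eventually_comp_neg {p : ℝ → Prop} (h : ∀ᶠ x in 𝓝[<] (1 : ℝ), p x) :
    ∀ᶠ x in 𝓝[>] (-1 : ℝ), p (-x) := by
  have h2 := tendsto_neg_nhdsGT (a := (-1 : ℝ))
  rw [neg_neg] at h2
  exact h2.eventually h

theorem rpow_neg_add_natCast (b : ℝ) (j : ℕ) {t : ℝ} (ht : 0 < t) :
    (t ^ (-b + (j : ℝ)) : ℝ) = t ^ (-b) * t ^ j := by
  rw [Real.rpow_add ht, Real.rpow_natCast]

theorem one_add_pos_eventually : ∀ᶠ x in 𝓝[>] (-1 : ℝ), 0 < 1 + x := by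
  filter_upwards [self_mem_nhdsWithin] with x hx
  have : -1 < x := hx
  linarith

theorem IsPhiMinus.hasExpansions (h : IsPhiMinus j f) :
    HasExpansions α β (X ^ j) 0 0 0 f where
  smooth := h.1
  left := by
    filter_upwards [h.2.1] with x hx
    simp [hx]
  right := by
    filter_upwards [eventually_comp_neg h.2.2] with x hx
    simp [hx]

theorem IsPsiMinus.hasExpansions (h : IsPsiMinus β j f) :
    HasExpansions α β 0 (X ^ j) 0 0 f where
  smooth := h.1
  left := by
    filter_upwards [h.2.1, one_add_pos_eventually] with x hx h0
    rw [hx, rpow_neg_add_natCast β j h0]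
    simp
  right := by
    filter_upwards [eventually_comp_neg h.2.2] with x hx
    simp [hx]

theorem IsPhiPlus.hasExpansions (h : IsPhiPlus j f) :
    HasExpansions α β 0 0 (X ^ j) 0 f where
  smooth := h.1
  left := by
    filter_upwards [h.2.1] with x hx
    simp [hx]
  right := by
    filter_upwards [eventually_comp_neg h.2.2] with x hx
    simp [hx]

theorem IsPsiPlus.hasExpansions (h : IsPsiPlus α j f) :
    HasExpansions α β 0 0 0 (X ^ j) f where
  smooth := h.1
  left := by
    filter_upwards [h.2.1] with x hx
    simp [hx]
  right := by
    filter_upwards [eventually_comp_neg h.2.2, one_add_pos_eventually] with x hx h0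
    rw [hx, sub_neg_eq_add, rpow_neg_add_natCast α j h0]
    simp

/-- A family of classes of functions with endpoint expansions is linearly independent modulo the
minimal domain if the coefficients of order below `n` determine its combinations. -/
theorem LimitCircle.linearIndependent_mkQ (hp : LimitCircle α β) {n : ℕ} (hn : 1 ≤ n) {ι : Type*}
    [Fintype ι] {P Q P' Q' : ι → ℂ[X]} {F : ι → ℝ → ℂ} {u : ι → L2 α β}
    (hF : ∀ i, HasExpansions α β (P i) (Q i) (P' i) (Q' i) (F i))
    (hu : ∀ i, u i =ᵐ[weightMeasure α β] F i)
    (hdet : ∀ c : ι → ℂ, (∀ j < n, ((∑ i, c i • P i).coeff j = 0 ∧ (∑ i, c i • Q i).coeff j = 0) ∧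
      (∑ i, c i • P' i).coeff j = 0 ∧ (∑ i, c i • Q' i).coeff j = 0) → c = 0) :
    LinearIndependent ℂ fun i => (minDomain α β n).mkQ (u i) := by
  rw [Fintype.linearIndependent_iff]
  intro c hc
  have h1 : ∑ i, c i • u i ∈ minDomain α β n := by
    rw [← Submodule.ker_mkQ (minDomain α β n), LinearMap.mem_ker, map_sum, ← hc]
    simp only [map_smul]
  obtain ⟨v, hv, hv'⟩ := ((hp.isMaxMinPair hn).mem_min_iff hp.symmetricRightInverse _).1 h1
  have h2 : (∑ i, c i • u i : L2 α β) =ᵐ[weightMeasure α β] ∑ i, c i • F i := by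
    have key : ∀ s : Finset ι,
        (∑ i ∈ s, c i • u i : L2 α β) =ᵐ[weightMeasure α β] ∑ i ∈ s, c i • F i := by
      classical
      intro s
      induction s using Finset.induction_on with
      | empty => simpa using Lp.coeFn_zero ℂ 2 (weightMeasure α β)
      | insert i s hi ih =>
        rw [Finset.sum_insert hi, Finset.sum_insert hi]
        exact (Lp.coeFn_add _ _).trans
          (((Lp.coeFn_smul _ _).trans ((hu i).const_smul (c i))).add ih)
    exact key Finset.univ
  rw [hv'] at h2
  exact congrFun (hdet c (hp.coeff_eq_zero n (HasExpansions.sum Finset.univ c hF) hv h2))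

end EndpointFunctions

/-- The endpoint functions, indexed by the endpoint, the kind and the exponent. -/
def endpointFamily {n : ℕ} {E : Type*} (φm ψm φp ψp : Fin n → E) :
    (Fin n ⊕ Fin n) ⊕ (Fin n ⊕ Fin n) → E :=
  Sum.elim (Sum.elim φm ψm) (Sum.elim φp ψp)

theorem endpointSpan_eq {α β : ℝ} {n : ℕ} {φ ψ : Fin n → ℝ → ℂ} {u : Fin n ⊕ Fin n → L2 α β}
    (hu : ∀ i, u i =ᵐ[weightMeasure α β] (Sum.elim φ ψ) i) :
    endpointSpan α β φ ψ = Submodule.span ℂ (range u) := by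
  rw [endpointSpan]
  congr 1
  ext v
  constructor
  · rintro ⟨j, h | h⟩
    · exact ⟨Sum.inl j, Lp.ext ((hu (Sum.inl j)).trans h.symm)⟩
    · exact ⟨Sum.inr j, Lp.ext ((hu (Sum.inr j)).trans h.symm)⟩
  · rintro ⟨j | j, rfl⟩
    · exact ⟨j, Or.inl (hu (Sum.inl j))⟩
    · exact ⟨j, Or.inr (hu (Sum.inr j))⟩

/-- The endpoint functions span a `4 n`-dimensional direct sum in the maximal domain that meets the
minimal domain only in `0`. -/
theorem LimitCircle.endpointSpan_properties {α β : ℝ} (hp : LimitCircle α β) {n : ℕ} (hn : 1 ≤ n)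
    {φp ψp φm ψm : Fin n → ℝ → ℂ} (hφp : ∀ j : Fin n, IsPhiPlus j (φp j))
    (hψp : ∀ j : Fin n, IsPsiPlus α j (ψp j)) (hφm : ∀ j : Fin n, IsPhiMinus j (φm j))
    (hψm : ∀ j : Fin n, IsPsiMinus β j (ψm j)) :
    Disjoint (endpointSpan α β φm ψm) (endpointSpan α β φp ψp) ∧
    endpointSpan α β φm ψm ⊔ endpointSpan α β φp ψp ≤ (maxOp α β n).domain ∧
    Module.finrank ℂ ↥(endpointSpan α β φm ψm ⊔ endpointSpan α β φp ψp) = 4 * n ∧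
    Disjoint (minDomain α β n) (endpointSpan α β φm ψm ⊔ endpointSpan α β φp ψp) := by
  let Y : Fin n → Polynomial ℂ := fun j => Polynomial.X ^ (j : ℕ)
  let F := endpointFamily φm ψm φp ψp
  have hF : ∀ i, HasExpansions α β (endpointFamily Y 0 0 0 i) (endpointFamily 0 Y 0 0 i)
      (endpointFamily 0 0 Y 0 i) (endpointFamily 0 0 0 Y i) (F i) := by
    rintro ((j | j) | (j | j))
    · exact (hφm j).hasExpansions
    · exact (hψm j).hasExpansions
    · exact (hφp j).hasExpansions
    · exact (hψp j).hasExpansions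
  let u : (Fin n ⊕ Fin n) ⊕ (Fin n ⊕ Fin n) → L2 α β := fun i => ((hF i).memLp hp).toLp _
  have hu : ∀ i, u i =ᵐ[weightMeasure α β] F i := fun i => ((hF i).memLp hp).coeFn_toLp
  have hli : LinearIndependent ℂ fun i => (minDomain α β n).mkQ (u i) := by
    refine hp.linearIndependent_mkQ hn hF hu fun c hc => ?_
    -- Each of the four expansion polynomials sees only one of the four families, and its
    -- coefficients are the scalars of that family.
    have hco : ∀ (j : Fin n) (d : Fin n → ℂ), (∑ i, d i • Y i).coeff j = d j := by
      intro j d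
      simp [Y, Polynomial.coeff_X_pow, Fin.val_inj]
    simp only [endpointFamily, Fintype.sum_sum_type, Sum.elim_inl, Sum.elim_inr, Pi.zero_apply,
      smul_zero, Finset.sum_const_zero, add_zero, zero_add] at hc
    funext i
    rcases i with (j | j) | (j | j)
    · exact (hco j _).symm.trans (hc j j.2).1.1
    · exact (hco j _).symm.trans (hc j j.2).1.2
    · exact (hco j _).symm.trans (hc j j.2).2.1
    · exact (hco j _).symm.trans (hc j j.2).2.2
  have hm : endpointSpan α β φm ψm = Submodule.span ℂ (u '' range Sum.inl) := by
    rw [← range_comp]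
    exact endpointSpan_eq fun i => hu (Sum.inl i)
  have hpl : endpointSpan α β φp ψp = Submodule.span ℂ (u '' range Sum.inr) := by
    rw [← range_comp]
    exact endpointSpan_eq fun i => hu (Sum.inr i)
  have hsum : endpointSpan α β φm ψm ⊔ endpointSpan α β φp ψp = Submodule.span ℂ (range u) := by
    rw [hm, hpl, ← Submodule.span_union, ← image_union, range_inl_union_range_inr, image_univ]
  have hli' : LinearIndependent ℂ u := LinearIndependent.of_comp _ hli
  refine ⟨?_, ?_, ?_, ?_⟩
  · rw [hm, hpl]
    exact hli'.disjoint_span_image isCompl_range_inl_range_inr.disjoint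
  · rw [hsum, Submodule.span_le]
    rintro _ ⟨i, rfl⟩
    obtain ⟨w, hw, -⟩ := (hF i).mem_maxGraph hp n (hu i)
    rw [← LimitCircle.graph_maxOp] at hw
    exact LinearPMap.mem_domain_of_mem_graph hw
  · rw [hsum, finrank_span_eq_card hli']
    simp only [Fintype.card_sum, Fintype.card_fin]
    ring
  · rw [hsum]
    have h1 := Submodule.range_ker_disjoint hli
    rw [Submodule.ker_mkQ] at h1
    exact h1.symm

end JacobiPowers

/-! ### Comparison of the two complements by dimension -/

theorem corollary4p8 (α β : ℝ) (hα₀ : 0 < α) (hα₁ : α < 1) (hβ₀ : 0 < β) (hβ₁ : β < 1)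
    (n : ℕ) (hn : 1 ≤ n)
    (φp ψp φm ψm : Fin n → ℝ → ℂ)
    (hφp : ∀ j : Fin n, JacobiPowers.IsPhiPlus j (φp j))
    (hψp : ∀ j : Fin n, JacobiPowers.IsPsiPlus α j (ψp j))
    (hφm : ∀ j : Fin n, JacobiPowers.IsPhiMinus j (φm j))
    (hψm : ∀ j : Fin n, JacobiPowers.IsPsiMinus β j (ψm j)) :
    -- both sums are direct
    Disjoint (JacobiPowers.defectPlus α β n) (JacobiPowers.defectMinus α β n) ∧
    Disjoint (JacobiPowers.endpointSpan α β φm ψm) (JacobiPowers.endpointSpan α β φp ψp) ∧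
    -- both lie in the maximal domain
    JacobiPowers.defectSum α β n ≤ (JacobiPowers.maxOp α β n).domain ∧
    JacobiPowers.endpointSpan α β φm ψm ⊔ JacobiPowers.endpointSpan α β φp ψp ≤
      (JacobiPowers.maxOp α β n).domain ∧
    -- both are `4 n`-dimensional and meet the minimal domain only in `0`
    Module.finrank ℂ ↥(JacobiPowers.defectSum α β n) = 4 * n ∧
    Module.finrank ℂ
      ↥(JacobiPowers.endpointSpan α β φm ψm ⊔ JacobiPowers.endpointSpan α β φp ψp) = 4 * n ∧
    Disjoint (JacobiPowers.minDomain α β n) (JacobiPowers.defectSum α β n) ∧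
    Disjoint (JacobiPowers.minDomain α β n)
      (JacobiPowers.endpointSpan α β φm ψm ⊔ JacobiPowers.endpointSpan α β φp ψp) ∧
    -- they coincide modulo the minimal domain
    (JacobiPowers.defectSum α β n).map (JacobiPowers.minDomain α β n).mkQ =
      (JacobiPowers.endpointSpan α β φm ψm ⊔ JacobiPowers.endpointSpan α β φp ψp).map
        (JacobiPowers.minDomain α β n).mkQ := by
  have hp : JacobiPowers.LimitCircle α β := ⟨hα₀, hα₁, hβ₀, hβ₁⟩
  have hV := hp.symmetricRightInverse
  have hA := hp.isMaxMinPair hn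
  obtain ⟨h1, h2, h3, h4⟩ := hp.endpointSpan_properties hn hφp hψp hφm hψm
  have h5 : Disjoint (JacobiPowers.minDomain α β n) (JacobiPowers.defectSum α β n) :=
    hA.disjoint_min_defect hV
  have h6 := hA.min_sup_defect hV
  have h7 : Module.finrank ℂ ↥(JacobiPowers.defectSum α β n) = 4 * n := by
    have h := hA.finrank_eq_of_isCompl hV h5 h6
    rw [hp.finrank_kernel] at h
    exact h.trans (by ring)
  refine ⟨hA.disjoint_defectSpace hV, h1, sup_le (hA.defectSpace_le hV _) (hA.defectSpace_le hV _),
    h2, h7, h3, h5, h4, ?_⟩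
  -- The defect spaces fill the whole quotient of the maximal domain, so the endpoint image is
  -- contained in theirs.
  have h8 : (JacobiPowers.maxOp α β n).domain.map (JacobiPowers.minDomain α β n).mkQ =
      (JacobiPowers.defectSum α β n).map (JacobiPowers.minDomain α β n).mkQ := by
    rw [← h6, JacobiPowers.map_mkQ_sup_eq]
    rfl
  -- `Module.finrank` is `0` in infinite dimension, so `4 n > 0`, from `n ≥ 1`, certifies the finite
  -- dimension on which the comparison of subspaces rests.
  have h9 : 0 < Module.finrank ℂ ↥(JacobiPowers.defectSum α β n) := by omega
  have := Module.finite_of_finrank_pos h9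
  refine (Submodule.eq_of_le_of_finrank_eq (h8 ▸ Submodule.map_mono h2) ?_).symm
  rw [JacobiPowers.finrank_map_mkQ h4, JacobiPowers.finrank_map_mkQ h5, h3]
  exact h7.symm
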